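/- **Setting.** Formulas are first-order, built with $\neg,\wedge,\vee,\Rightarrow,\forall,\exists$. A *tableau* for a set $\Gamma$ of formulas is a finite tree of sets of formulas rooted at $\Gamma$ and grown by non-destructive rules: $\alpha$-formulas ($A\wedge B$, $\neg(A\vee B)$, $\neg(A\Rightarrow B)$, $\neg\neg A$) add their components; $\beta$-formulas ($A\vee B$, $A\Rightarrow B$, $\neg(A\wedge B)$) split the branch; $\gamma$-formulas ($\forall x\,A$, $\neg\exists x\,A$) add the instance with a fresh free variable $X$; $\delta$-formulas ($\exists x\,A$, $\neg\forall x\,A$) add the instance with the Skolem term $f(X_1,\dots,X_k)$, where $f$ is a fresh function symbol and $X_1,\dots,X_k$ are the distinct free variables of the $\delta$-formula. Variables and symbols introduced by different $\gamma$- resp. $\delta$-rules of the tableau are different. $(T,\sigma)$ is a *closed tableau* if $\sigma$ is a ground substitution such that each leaf of $T$ contains formulas $A$, $\neg B$ with $\sigma A=\sigma B$. An (open) *GS3 tree* over $(T,\sigma)$ is a finite tree of one-sided sequents (sets of ground formulas), whose rules, read from the root to the leaves, are: the axiom (closing a sequent that contains $A$ and $\neg A$); weakening (from $\Delta$ one gets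 $\Delta, A$, $A$ being dropped on the way up); the non-destructive $\alpha$- and $\beta$-rules; the $\gamma$-rule with any ground term; and the $\delta$-rule, applied to a formula $\sigma F$ with witness $\sigma\varepsilon$, where $\varepsilon$ is the Skolem term of an application of the $\delta$-rule to $F$ in $T$ and the term $\sigma\varepsilon$ does not occur in the sequent. Its *open leaves* are the leaves not closed by an axiom; they are identified with paths from the root. An *initial part* of a GS3 tree is obtained by cutting it at some nodes, which become open leaves. A *partial link* from $\pi$ to $\theta$ is a partial map $\mu$ from open leaves of $\pi$ to open leaves of $\theta$ such that the sequent at $s$ contains the sequent at $\mu(s)$ whenever $\mu(s)$ is defined. $\pi$ is *bilinked* to $\theta_0$ and $\theta_1$ by $\mu_0,\mu_1$ if these are partial links from $\pi$ to $\theta_0$ and to $\theta_1$ whose domains are disjoint and together cover all open leaves of $\pi$. **Theorem ($\delta$-theorem).** Let $(T,\sigma)$ be a closed tableau rooted at $\Gamma$, such that $\sigma\Gamma$ contains no Skolem symbol introduced in $T$ (for instance, $\Gamma$ consists of closed formulas). Let $\delta$ be the Skolem term produced by an application in $T$ of the $\delta$-rule to a formula $\exists x\,D(x)$ (or to a formula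 $\neg\forall x\,D'(x)$, with $D=\neg D'$). Let $\theta$ be an open GS3 tree over $(T,\sigma)$, rooted at $\sigma\Gamma$, in which all formulas are $\sigma$-instances of formulas of $T$ and all open leaves contain $\sigma\Gamma$. Let $\mathcal B$ be a set of open leaves of $\theta$, each containing $\sigma(\exists x\,D(x))$ (resp. $\sigma(\neg\forall x\,D'(x))$), and let $\pi_0$ be an initial part of $\theta$. Then there is a GS3 tree $\pi_1$ over $(T,\sigma)$, rooted at $\sigma\Gamma$, that is bilinked to $\pi_0$ and $\theta$ by maps $\mu_{\pi_0}$ and $\mu_\theta$ such that: 1. there is no leaf $s$ of $\pi_1$ with $\mu_\theta(s)\in\mathcal B$; 2. for each leaf $s$ such that $\mu_{\pi_0}(s)$ is a prefix of (or equal to) a path in $\mathcal B$, the formulas of $s$ are those of $\mu_{\pi_0}(s)$ together with $\sigma(D(\delta))$; 3. each other leaf $s$ has exactly the same formulas as the leaf $\mu_{\pi_0}(s)$ or $\mu_\theta(s)$ that it is linked to. -/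

import Mathlib

universe u v w w'

namespace SkolemTableau

/-! ### First-order syntax

Formulas have the primitive connectives `¬, ∧, ∨, ⇒, ∀, ∃`.  `Fml L V n` is the type of formulas over
the language `L` with free variables from `V` and `n` variables still to be bound, written as
de Bruijn indices (`0` is the innermost one).  `Fml L V 0` is the type of formulas proper and
`Fml L Empty 0` the type of ground formulas (no free variables). -/

inductive Fml (L : FirstOrder.Language.{u, v}) (V : Type w) : ℕ → Type (max u v w)
  | rel {n k : ℕ} (R : L.Relations k) (ts : Fin k → L.Term (V ⊕ Fin n)) : Fml L V n
  | neg {n : ℕ} (A : Fml L V n) : Fml L V n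
  | and {n : ℕ} (A B : Fml L V n) : Fml L V n
  | or {n : ℕ} (A B : Fml L V n) : Fml L V n
  | imp {n : ℕ} (A B : Fml L V n) : Fml L V n
  | all {n : ℕ} (A : Fml L V (n + 1)) : Fml L V n
  | ex {n : ℕ} (A : Fml L V (n + 1)) : Fml L V n

/-- Syntactic equality or proper subterm: `s` occurs in the term. -/
def TermOccurs {L : FirstOrder.Language.{u, v}} {α : Type w} (s : L.Term α) : L.Term α → Prop
  | .var x => s = .var x
  | .func f ts => s = .func f ts ∨ ∃ i, TermOccurs s (ts i)

/-- The function symbol `g` (given with its arity) occurs in the term. -/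
def TermHasFun {L : FirstOrder.Language.{u, v}} {α : Type w} (g : Σ k, L.Functions k) :
    L.Term α → Prop
  | .var _ => False
  | .func (l := k) f ts => g = ⟨k, f⟩ ∨ ∃ i, TermHasFun g (ts i)

namespace Fml

variable {L : FirstOrder.Language.{u, v}} {V : Type w}

/-- The term `s` (which contains no bound variable) occurs in the formula. -/
def Occurs (s : L.Term V) : {n : ℕ} → Fml L V n → Prop
  | _, rel _ ts => ∃ i, TermOccurs (s.relabel Sum.inl) (ts i)
  | _, neg A => Occurs s A
  | _, and A B => Occurs s A ∨ Occurs s B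
  | _, or A B => Occurs s A ∨ Occurs s B
  | _, imp A B => Occurs s A ∨ Occurs s B
  | _, all A => Occurs s A
  | _, ex A => Occurs s A

/-- The function symbol `g` occurs in the formula. -/
def HasFun (g : Σ k, L.Functions k) : {n : ℕ} → Fml L V n → Prop
  | _, rel _ ts => ∃ i, TermHasFun g (ts i)
  | _, neg A => HasFun g A
  | _, and A B => HasFun g A ∨ HasFun g B
  | _, or A B => HasFun g A ∨ HasFun g B
  | _, imp A B => HasFun g A ∨ HasFun g B
  | _, all A => HasFun g A
  | _, ex A => HasFun g A

/-- The free variables that occur in a formula. -/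
def fv {n : ℕ} (A : Fml L V n) : Set V := {x | A.Occurs (.var x)}

/-- Extension of a substitution under one more binder. -/
def liftSubst {W : Type w'} {n m : ℕ} (τ : V ⊕ Fin n → L.Term (W ⊕ Fin m)) :
    V ⊕ Fin (n + 1) → L.Term (W ⊕ Fin (m + 1))
  | .inl x => (τ (.inl x)).relabel (Sum.map id Fin.succ)
  | .inr i => Fin.cases (.var (.inr 0)) (fun j => (τ (.inr j)).relabel (Sum.map id Fin.succ)) i

/-- Capture-avoiding simultaneous substitution. -/
def subst {W : Type w'} : {n m : ℕ} → (V ⊕ Fin n → L.Term (W ⊕ Fin m)) → Fml L V n → Fml L W m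
  | _, _, τ, rel R ts => rel R (fun i => (ts i).subst τ)
  | _, _, τ, neg A => neg (subst τ A)
  | _, _, τ, and A B => and (subst τ A) (subst τ B)
  | _, _, τ, or A B => or (subst τ A) (subst τ B)
  | _, _, τ, imp A B => imp (subst τ A) (subst τ B)
  | _, _, τ, all A => all (subst (liftSubst τ) A)
  | _, _, τ, ex A => ex (subst (liftSubst τ) A)

/-- `A(t)`, for a formula `A(x)` with one variable `x` left to be bound. -/
def inst (A : Fml L V 1) (t : L.Term V) : Fml L V 0 :=
  A.subst (Sum.elim (fun x => .var (.inl x)) (fun _ => t.relabel Sum.inl))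

/-- The ground instance of a formula under a substitution of ground terms for its free
variables. -/
def ground {V : Type w} (σ : V → L.Term Empty) {n : ℕ} (A : Fml L V n) : Fml L Empty n :=
  A.subst (Sum.elim (fun x => (σ x).relabel Sum.inl) (fun i => .var (.inr i)))

end Fml

/-! ### The classification of formulas -/

section Classification

variable {L : FirstOrder.Language.{u, v}} {V : Type w}

/-- An `α`-formula and the set of its components. -/
inductive IsAlpha : Fml L V 0 → Set (Fml L V 0) → Prop
  | and (A B : Fml L V 0) : IsAlpha (.and A B) {A, B}
  | negOr (A B : Fml L V 0) : IsAlpha (.neg (.or A B)) {.neg A, .neg B}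
  | negImp (A B : Fml L V 0) : IsAlpha (.neg (.imp A B)) {A, .neg B}
  | negNeg (A : Fml L V 0) : IsAlpha (.neg (.neg A)) {A}

/-- A `β`-formula and its two components. -/
inductive IsBeta : Fml L V 0 → Fml L V 0 → Fml L V 0 → Prop
  | or (A B : Fml L V 0) : IsBeta (.or A B) A B
  | imp (A B : Fml L V 0) : IsBeta (.imp A B) (.neg A) B
  | negAnd (A B : Fml L V 0) : IsBeta (.neg (.and A B)) (.neg A) (.neg B)

/-- A `γ`-formula and its matrix. -/
inductive IsGamma : Fml L V 0 → Fml L V 1 → Prop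
  | all (A : Fml L V 1) : IsGamma (.all A) A
  | negEx (A : Fml L V 1) : IsGamma (.neg (.ex A)) (.neg A)

/-- A `δ`-formula and its matrix. -/
inductive IsDelta : Fml L V 0 → Fml L V 1 → Prop
  | ex (A : Fml L V 1) : IsDelta (.ex A) A
  | negAll (A : Fml L V 1) : IsDelta (.neg (.all A)) (.neg A)

end Classification

/-! ### Free-variable tableaux with inner Skolemization -/

/-- The Skolem term `f(x₁, …, xₖ)`. -/
def skTerm {L : FirstOrder.Language.{u, v}} {V : Type w} {k : ℕ}
    (f : L.Functions k) (xs : Fin k → V) : L.Term V :=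
  .func f (fun i => .var (xs i))

/-- Tableau trees; the index is the set of formulas carried by the root.  The rules are
non-destructive, so that each node carries all formulas of the path from the root to it.  In the
`γ`-rule the free variable `x` is new on the branch; in the `δ`-rule the symbol `f` is new on the
branch, and its arguments are the free variables of the Skolemized formula, each listed once. -/
inductive Tableau {L : FirstOrder.Language.{u, v}} {V : Type w} :
    Set (Fml L V 0) → Type (max u v w)
  | leaf (Δ : Set (Fml L V 0)) : Tableau Δ
  | alpha {Δ : Set (Fml L V 0)} (F : Fml L V 0) (S : Set (Fml L V 0))
      (hF : F ∈ Δ) (hS : IsAlpha F S) (T : Tableau (Δ ∪ S)) : Tableau Δ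
  | beta {Δ : Set (Fml L V 0)} (F A B : Fml L V 0)
      (hF : F ∈ Δ) (hAB : IsBeta F A B)
      (T₁ : Tableau (insert A Δ)) (T₂ : Tableau (insert B Δ)) : Tableau Δ
  | gamma {Δ : Set (Fml L V 0)} (F : Fml L V 0) (A : Fml L V 1) (x : V)
      (hF : F ∈ Δ) (hA : IsGamma F A) (hx : ∀ G ∈ Δ, x ∉ G.fv)
      (T : Tableau (insert (A.inst (.var x)) Δ)) : Tableau Δ
  | delta {Δ : Set (Fml L V 0)} (F : Fml L V 0) (A : Fml L V 1)
      (k : ℕ) (f : L.Functions k) (xs : Fin k → V)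
      (hF : F ∈ Δ) (hA : IsDelta F A) (hf : ∀ G ∈ Δ, ¬ G.HasFun ⟨k, f⟩)
      (hxs : Function.Injective xs) (hfv : Set.range xs = A.fv)
      (T : Tableau (insert (A.inst (skTerm f xs)) Δ)) : Tableau Δ

namespace Tableau

variable {L : FirstOrder.Language.{u, v}} {V : Type w}

/-- The free variables introduced by the `γ`-rules, one entry per rule application. -/
def newVars : {Δ : Set (Fml L V 0)} → Tableau Δ → List V
  | _, leaf _ => []
  | _, alpha _ _ _ _ T => T.newVars
  | _, beta _ _ _ _ _ T₁ T₂ => T₁.newVars ++ T₂.newVars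
  | _, gamma _ _ x _ _ _ T => x :: T.newVars
  | _, delta _ _ _ _ _ _ _ _ _ _ T => T.newVars

/-- The Skolem symbols introduced by the `δ`-rules, one entry per rule application. -/
def skolems : {Δ : Set (Fml L V 0)} → Tableau Δ → List (Σ k, L.Functions k)
  | _, leaf _ => []
  | _, alpha _ _ _ _ T => T.skolems
  | _, beta _ _ _ _ _ T₁ T₂ => T₁.skolems ++ T₂.skolems
  | _, gamma _ _ _ _ _ _ T => T.skolems
  | _, delta _ _ k f _ _ _ _ _ _ T => ⟨k, f⟩ :: T.skolems

/-- The freshness conditions hold in the whole tableau, not only along each branch: different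
applications of the `γ`-rule (resp. `δ`-rule) introduce different variables (resp. symbols). -/
def Fresh {Δ : Set (Fml L V 0)} (T : Tableau Δ) : Prop :=
  T.newVars.Nodup ∧ T.skolems.Nodup

/-- All formulas that appear in the tableau. -/
def formulas : {Δ : Set (Fml L V 0)} → Tableau Δ → Set (Fml L V 0)
  | Δ, leaf _ => Δ
  | Δ, alpha _ _ _ _ T => Δ ∪ T.formulas
  | Δ, beta _ _ _ _ _ T₁ T₂ => Δ ∪ T₁.formulas ∪ T₂.formulas
  | Δ, gamma _ _ _ _ _ _ T => Δ ∪ T.formulas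
  | Δ, delta _ _ _ _ _ _ _ _ _ _ T => Δ ∪ T.formulas

/-- The applications of the `δ`-rule in the tableau: the triples consisting of the `δ`-formula, its
matrix and the Skolem term. -/
def deltas : {Δ : Set (Fml L V 0)} → Tableau Δ → Set (Fml L V 0 × Fml L V 1 × L.Term V)
  | _, leaf _ => ∅
  | _, alpha _ _ _ _ T => T.deltas
  | _, beta _ _ _ _ _ T₁ T₂ => T₁.deltas ∪ T₂.deltas
  | _, gamma _ _ _ _ _ _ T => T.deltas
  | _, delta F A _ f xs _ _ _ _ _ T => insert (F, A, skTerm f xs) T.deltas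

/-- `σ` closes all branches at once: each leaf carries formulas `A` and `¬ B` with `σ A = σ B`. -/
def ClosedBy (σ : V → L.Term Empty) : {Δ : Set (Fml L V 0)} → Tableau Δ → Prop
  | Δ, leaf _ => ∃ A B, A ∈ Δ ∧ Fml.neg B ∈ Δ ∧ A.ground σ = B.ground σ
  | _, alpha _ _ _ _ T => T.ClosedBy σ
  | _, beta _ _ _ _ _ T₁ T₂ => T₁.ClosedBy σ ∧ T₂.ClosedBy σ
  | _, gamma _ _ _ _ _ _ T => T.ClosedBy σ
  | _, delta _ _ _ _ _ _ _ _ _ _ T => T.ClosedBy σ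

/-- The ground `δ`-formulas of `(T, σ)`, each with the `σ`-instance of its Skolem term. -/
def skolemTable (σ : V → L.Term Empty) {Δ : Set (Fml L V 0)} (T : Tableau Δ) :
    Set (Fml L Empty 0 × L.Term Empty) :=
  {q | ∃ F A t, (F, A, t) ∈ T.deltas ∧ q = (F.ground σ, t.subst σ)}

end Tableau

/-! ### Open GS3 proof-trees with Skolem terms -/

/-- (Open) GS3 proof-trees of ground one-sided sequents; the index is the sequent at the root, read
from the root towards the leaves.  Sequents are sets, contraction is built into each rule.  The
witness of a `δ`-rule is a Skolem term that `sk` assigns to the principal formula, and it has to be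
fresh: it occurs nowhere in the sequent. -/
inductive GS3 {L : FirstOrder.Language.{u, v}} (sk : Set (Fml L Empty 0 × L.Term Empty)) :
    Set (Fml L Empty 0) → Type (max u v)
  | hyp (Δ : Set (Fml L Empty 0)) : GS3 sk Δ
  | ax {Δ : Set (Fml L Empty 0)} (A : Fml L Empty 0) (hA : A ∈ Δ) (hn : Fml.neg A ∈ Δ) : GS3 sk Δ
  | weak {Δ : Set (Fml L Empty 0)} (A : Fml L Empty 0) (Δ' : Set (Fml L Empty 0))
      (h : Δ = insert A Δ') (d : GS3 sk Δ') : GS3 sk Δ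
  | alpha {Δ : Set (Fml L Empty 0)} (F : Fml L Empty 0) (S : Set (Fml L Empty 0))
      (hF : F ∈ Δ) (hS : IsAlpha F S) (d : GS3 sk (Δ ∪ S)) : GS3 sk Δ
  | beta {Δ : Set (Fml L Empty 0)} (F A B : Fml L Empty 0)
      (hF : F ∈ Δ) (hAB : IsBeta F A B)
      (d₁ : GS3 sk (insert A Δ)) (d₂ : GS3 sk (insert B Δ)) : GS3 sk Δ
  | gamma {Δ : Set (Fml L Empty 0)} (F : Fml L Empty 0) (A : Fml L Empty 1) (t : L.Term Empty)
      (hF : F ∈ Δ) (hA : IsGamma F A) (d : GS3 sk (insert (A.inst t) Δ)) : GS3 sk Δ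
  | delta {Δ : Set (Fml L Empty 0)} (F : Fml L Empty 0) (A : Fml L Empty 1) (t : L.Term Empty)
      (hF : F ∈ Δ) (hA : IsDelta F A) (hsk : (F, t) ∈ sk) (hfresh : ∀ G ∈ Δ, ¬ G.Occurs t)
      (d : GS3 sk (insert (A.inst t) Δ)) : GS3 sk Δ

/-- Positions in a tree: `false` is the left or only child, `true` the right child. -/
abbrev TreePath := List Bool

namespace GS3

variable {L : FirstOrder.Language.{u, v}} {sk : Set (Fml L Empty 0 × L.Term Empty)}

/-- All formulas that appear in the tree. -/
def formulas : {Δ : Set (Fml L Empty 0)} → GS3 sk Δ → Set (Fml L Empty 0)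
  | Δ, hyp _ => Δ
  | Δ, ax _ _ _ => Δ
  | Δ, weak _ _ _ d => Δ ∪ d.formulas
  | Δ, alpha _ _ _ _ d => Δ ∪ d.formulas
  | Δ, beta _ _ _ _ _ d₁ d₂ => Δ ∪ d₁.formulas ∪ d₂.formulas
  | Δ, gamma _ _ _ _ _ d => Δ ∪ d.formulas
  | Δ, delta _ _ _ _ _ _ _ d => Δ ∪ d.formulas

/-- `d.Leaf p S`: the tree `d` has an open leaf at the position `p`, and `S` is its sequent. -/
def Leaf : {Δ : Set (Fml L Empty 0)} → GS3 sk Δ → TreePath → Set (Fml L Empty 0) → Prop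
  | Δ, hyp _, p, S => p = [] ∧ S = Δ
  | _, ax _ _ _, _, _ => False
  | _, weak _ _ _ d, p, S => ∃ q, p = false :: q ∧ d.Leaf q S
  | _, alpha _ _ _ _ d, p, S => ∃ q, p = false :: q ∧ d.Leaf q S
  | _, beta _ _ _ _ _ d₁ d₂, p, S =>
      (∃ q, p = false :: q ∧ d₁.Leaf q S) ∨ (∃ q, p = true :: q ∧ d₂.Leaf q S)
  | _, gamma _ _ _ _ _ d, p, S => ∃ q, p = false :: q ∧ d.Leaf q S
  | _, delta _ _ _ _ _ _ _ d, p, S => ∃ q, p = false :: q ∧ d.Leaf q S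

/-- `π₀` is an initial part of `π`: each rule of `π₀` is the rule of `π` at the same position. -/
inductive InitialPart : {Δ : Set (Fml L Empty 0)} → GS3 sk Δ → GS3 sk Δ → Prop
  | hyp {Δ : Set (Fml L Empty 0)} (d : GS3 sk Δ) : InitialPart (.hyp Δ) d
  | ax {Δ : Set (Fml L Empty 0)} (A : Fml L Empty 0) (hA : A ∈ Δ) (hn : Fml.neg A ∈ Δ) :
      InitialPart (.ax A hA hn) (.ax A hA hn)
  | weak {Δ : Set (Fml L Empty 0)} (A : Fml L Empty 0) (Δ' : Set (Fml L Empty 0))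
      (h : Δ = insert A Δ') (d₀ d : GS3 sk Δ') (hd : InitialPart d₀ d) :
      InitialPart (.weak A Δ' h d₀) (.weak A Δ' h d)
  | alpha {Δ : Set (Fml L Empty 0)} (F : Fml L Empty 0) (S : Set (Fml L Empty 0))
      (hF : F ∈ Δ) (hS : IsAlpha F S) (d₀ d : GS3 sk (Δ ∪ S)) (hd : InitialPart d₀ d) :
      InitialPart (.alpha F S hF hS d₀) (.alpha F S hF hS d)
  | beta {Δ : Set (Fml L Empty 0)} (F A B : Fml L Empty 0) (hF : F ∈ Δ) (hAB : IsBeta F A B)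
      (d₀ d : GS3 sk (insert A Δ)) (e₀ e : GS3 sk (insert B Δ))
      (hd : InitialPart d₀ d) (he : InitialPart e₀ e) :
      InitialPart (.beta F A B hF hAB d₀ e₀) (.beta F A B hF hAB d e)
  | gamma {Δ : Set (Fml L Empty 0)} (F : Fml L Empty 0) (A : Fml L Empty 1) (t : L.Term Empty)
      (hF : F ∈ Δ) (hA : IsGamma F A) (d₀ d : GS3 sk (insert (A.inst t) Δ))
      (hd : InitialPart d₀ d) :
      InitialPart (.gamma F A t hF hA d₀) (.gamma F A t hF hA d)
  | delta {Δ : Set (Fml L Empty 0)} (F : Fml L Empty 0) (A : Fml L Empty 1) (t : L.Term Empty)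
      (hF : F ∈ Δ) (hA : IsDelta F A) (hsk : (F, t) ∈ sk) (hfresh : ∀ G ∈ Δ, ¬ G.Occurs t)
      (d₀ d : GS3 sk (insert (A.inst t) Δ)) (hd : InitialPart d₀ d) :
      InitialPart (.delta F A t hF hA hsk hfresh d₀) (.delta F A t hF hA hsk hfresh d)

/-- The domain of a partial map between positions. -/
def dom (μ : TreePath → Option TreePath) : Set TreePath := {s | ∃ b, μ s = some b}

/-- The set of positions of the open leaves. -/
def leaves {Δ : Set (Fml L Empty 0)} (d : GS3 sk Δ) : Set TreePath := {p | ∃ S, d.Leaf p S}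

/-- `π` is partially linked to `θ` by `μ`, a partial map from the open leaves of `π` to those of
`θ`: a leaf of `π` contains all formulas of the leaf of `θ` that it is linked to. -/
def PartialLink {Δ Δ' : Set (Fml L Empty 0)} (π : GS3 sk Δ) (θ : GS3 sk Δ')
    (μ : TreePath → Option TreePath) : Prop :=
  ∀ s b, μ s = some b → ∃ S R, π.Leaf s S ∧ θ.Leaf b R ∧ R ⊆ S

/-- `π` is bilinked to `θ₀` and `θ₁` by `μ₀` and `μ₁`: both are partial links, and each open leaf of
`π` is in the domain of exactly one of them. -/
structure Bilink {Δ Δ₀ Δ₁ : Set (Fml L Empty 0)} (π : GS3 sk Δ) (θ₀ : GS3 sk Δ₀) (θ₁ : GS3 sk Δ₁)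
    (μ₀ μ₁ : TreePath → Option TreePath) : Prop where
  link₀ : PartialLink π θ₀ μ₀
  link₁ : PartialLink π θ₁ μ₁
  disjoint : dom μ₀ ∩ dom μ₁ = ∅
  cover : dom μ₀ ∪ dom μ₁ = π.leaves

end GS3

/-- `p` is a prefix of (possibly equal to) some path of `B`. -/
def IsPrefixOf (p : TreePath) (B : Set TreePath) : Prop := ∃ b ∈ B, p <+: b

end SkolemTableau

open SkolemTableau

/-! Carry a finite set `E` of applications of the `δ`-rule in `T` and derive `σΓ` together with the
ground instances `G q`, `q ∈ E`. Replay `π₀` with these instances added to every sequent. A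
`δ`-inference producing `G q` is superfluous if `q ∈ E`. Otherwise its witness must be made fresh,
so the instances in which it occurs are weakened away and `q` joins `E` (`replay`).

At a leaf `p` of `π₀` that is no prefix of a path in `B`, the extra instances are dropped. At a
prefix of such a path, if the distinguished application lies in `E`, everything extra but `σ(D(δ))`
is dropped. If not, the part of `θ` above `p` is replayed as well. Its leaves outside `B` are
acceptable after weakening. A leaf in `B` contains the `δ`-formula and `σΓ`, so one weakens to `σΓ`,
that formula and the instances without `σδ`, applies the `δ`-rule if `D(δ)` is still missing, and
starts again from `σΓ` and the new set.

Termination is the crux, because `E` also loses elements. `exists_rank` shows that if the witness of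
`q` occurs in `G q'` with `q' ≠ q`, then `q` has smaller rank. The rank is lexicographic: first the
height of the ground witness, then a numbering of the Skolem symbols compatible with their nesting
in the tableau. So adding `q` removes only elements of higher rank, and `exists_weight` turns this
into a bounded weight that strictly grows with each addition. -/

namespace SkolemTableau

variable {L : FirstOrder.Language.{u, v}} {V : Type w}

/-! ### Terms -/

section Terms

variable {α β γ : Type*}

theorem subst_subst (t : L.Term α) (τ : α → L.Term β) (τ' : β → L.Term γ) :
    (t.subst τ).subst τ' = t.subst (fun a => (τ a).subst τ') := by
  induction t with
  | var => rfl
  | func f ts ih => simp only [FirstOrder.Language.Term.subst, ih]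

theorem relabel_eq_subst (t : L.Term α) (g : α → β) :
    t.relabel g = t.subst (fun a => .var (g a)) := by
  induction t with
  | var => rfl
  | func f ts ih => simp only [FirstOrder.Language.Term.subst, FirstOrder.Language.Term.relabel, ih]

theorem relabel_subst (t : L.Term α) (g : α → β) (τ : β → L.Term γ) :
    (t.relabel g).subst τ = t.subst (fun a => τ (g a)) := by
  rw [relabel_eq_subst, subst_subst]; rfl

theorem subst_relabel (t : L.Term α) (τ : α → L.Term β) (g : β → γ) :
    (t.subst τ).relabel g = t.subst (fun a => (τ a).relabel g) := by
  simp only [relabel_eq_subst, subst_subst]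

theorem relabel_injective {g : α → β} (hg : Function.Injective g) {s t : L.Term α}
    (h : s.relabel g = t.relabel g) : s = t := by
  induction s generalizing t with
  | var a =>
    cases t with
    | var b => simpa [FirstOrder.Language.Term.relabel, hg.eq_iff] using h
    | func f ts => simp [FirstOrder.Language.Term.relabel] at h
  | func f ts ih =>
    cases t with
    | var b => simp [FirstOrder.Language.Term.relabel] at h
    | func f' ts' =>
      simp only [FirstOrder.Language.Term.relabel, FirstOrder.Language.Term.func.injEq] at h
      obtain ⟨rfl, h⟩ := h
      obtain ⟨rfl, h⟩ := h
      rw [heq_iff_eq] at h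
      congr 1
      funext i
      exact ih i (congrFun h i)

/-- The outermost function symbol of a term. -/
def termHead : L.Term α → Option (Σ k, L.Functions k)
  | .var _ => none
  | .func (l := k) f _ => some ⟨k, f⟩

theorem termHead_subst {t : L.Term α} {g : Σ k, L.Functions k} (h : termHead t = some g)
    (τ : α → L.Term β) : termHead (t.subst τ) = some g := by
  cases t with
  | var => simp [termHead] at h
  | func f ts => exact h

/-- The height of a term, constants having height `0`. -/
def termHeight : L.Term α → ℕ
  | .var _ => 0
  | .func _ ts => Finset.univ.sup fun i => termHeight (ts i) + 1

theorem termHeight_lt {k : ℕ} (f : L.Functions k) (ts : Fin k → L.Term α) (i : Fin k) :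
    termHeight (ts i) < termHeight (.func f ts) :=
  Finset.le_sup (f := fun i => termHeight (ts i) + 1) (Finset.mem_univ i)

theorem termHeight_le_of_occurs {s t : L.Term α} (h : TermOccurs s t) :
    termHeight s ≤ termHeight t := by
  induction t with
  | var x => exact le_of_eq (congrArg _ h)
  | func f ts ih =>
    rcases h with rfl | ⟨i, hi⟩
    · rfl
    · exact (ih i hi).trans (termHeight_lt f ts i).le

theorem termHasFun_of_occurs {s t : L.Term α} {g : Σ k, L.Functions k} (h : TermOccurs s t)
    (hs : TermHasFun g s) : TermHasFun g t := by
  induction t with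
  | var x => rwa [show s = _ from h] at hs
  | func f ts ih =>
    rcases h with rfl | ⟨i, hi⟩
    · exact hs
    · exact Or.inr ⟨i, ih i hi⟩

theorem termOccurs_trans {r s t : L.Term α} (h : TermOccurs s t) (hr : TermOccurs r s) :
    TermOccurs r t := by
  induction t with
  | var x => rwa [show s = _ from h] at hr
  | func f ts ih =>
    rcases h with rfl | ⟨i, hi⟩
    · exact hr
    · exact Or.inr ⟨i, ih i hi⟩

theorem termHasFun_of_head {t : L.Term α} {g : Σ k, L.Functions k} (h : termHead t = some g) :
    TermHasFun g t := by
  cases t with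
  | var => simp [termHead] at h
  | func f ts => exact Or.inl (Option.some.inj h).symm

theorem termHasFun_subst {t : L.Term α} {g : Σ k, L.Functions k} (τ : α → L.Term β)
    (h : TermHasFun g t) : TermHasFun g (t.subst τ) := by
  induction t with
  | var => exact h.elim
  | func f ts ih => exact h.imp id fun ⟨i, hi⟩ => ⟨i, ih i hi⟩

theorem termHasFun_of_subst {t : L.Term α} {g : Σ k, L.Functions k} {τ : α → L.Term β}
    (h : TermHasFun g (t.subst τ)) : TermHasFun g t ∨ ∃ a, TermHasFun g (τ a) := by
  induction t with
  | var a => exact Or.inr ⟨a, h⟩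
  | func f ts ih =>
    rcases h with h | ⟨i, hi⟩
    · exact Or.inl (Or.inl h)
    · exact (ih i hi).imp (fun h => Or.inr ⟨i, h⟩) id

theorem termHasFun_relabel {t : L.Term α} {g : Σ k, L.Functions k} {r : α → β} :
    TermHasFun g (t.relabel r) ↔ TermHasFun g t := by
  rw [relabel_eq_subst]
  exact ⟨fun h => (termHasFun_of_subst h).elim id fun ⟨_, h⟩ => h.elim, termHasFun_subst _⟩

theorem termOccurs_var_of_subst {t : L.Term α} {τ : α → L.Term β} {b : β}
    (h : TermOccurs (.var b) (t.subst τ)) :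
    ∃ a, TermOccurs (.var a) t ∧ TermOccurs (.var b) (τ a) := by
  induction t with
  | var a => exact ⟨a, rfl, h⟩
  | func f ts ih =>
    rcases h with h | ⟨i, hi⟩
    · cases h
    · obtain ⟨a, h₁, h₂⟩ := ih i hi
      exact ⟨a, Or.inr ⟨i, h₁⟩, h₂⟩

theorem termOccurs_of_relabel {s t : L.Term α} {r : α → β} (hr : Function.Injective r)
    (h : TermOccurs (s.relabel r) (t.relabel r)) : TermOccurs s t := by
  induction t with
  | var a => exact relabel_injective hr h
  | func f ts ih =>
    rcases h with h | ⟨i, hi⟩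
    · exact Or.inl (relabel_injective hr h)
    · exact Or.inr ⟨i, ih i hi⟩

theorem termOccurs_relabel {s t : L.Term α} (r : α → β) (h : TermOccurs s t) :
    TermOccurs (s.relabel r) (t.relabel r) := by
  induction t with
  | var a => exact congrArg _ h
  | func f ts ih =>
    rcases h with rfl | ⟨i, hi⟩
    · exact Or.inl rfl
    · exact Or.inr ⟨i, ih i hi⟩

/-- An occurrence of a term in a substitution instance lies inside the image of a variable or is
the image of a subterm with the same head symbol. -/
theorem termOccurs_subst {s : L.Term β} {t : L.Term α} {τ : α → L.Term β}
    (h : TermOccurs s (t.subst τ)) :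
    (∃ a, TermOccurs (.var a) t ∧ TermOccurs s (τ a)) ∨
      ∃ r, TermOccurs r t ∧ termHead r = termHead s ∧ s = r.subst τ := by
  induction t with
  | var a => exact Or.inl ⟨a, rfl, h⟩
  | func f ts ih =>
    rcases h with rfl | ⟨i, hi⟩
    · exact Or.inr ⟨_, Or.inl rfl, rfl, rfl⟩
    · rcases ih i hi with ⟨a, h₁, h₂⟩ | ⟨r, h₁, h₂⟩
      · exact Or.inl ⟨a, Or.inr ⟨i, h₁⟩, h₂⟩
      · exact Or.inr ⟨r, Or.inr ⟨i, h₁⟩, h₂⟩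

end Terms

/-! ### Substitution in formulas -/

section Subst

variable {W X : Type*} {n m k : ℕ}

theorem liftSubst_relabel (τ : V ⊕ Fin n → L.Term (W ⊕ Fin m)) (a : V ⊕ Fin n) :
    Fml.liftSubst τ (Sum.map id Fin.succ a) = (τ a).relabel (Sum.map id Fin.succ) := by
  rcases a with x | i <;> rfl

theorem liftSubst_comp (τ : V ⊕ Fin n → L.Term (W ⊕ Fin m)) (τ' : W ⊕ Fin m → L.Term (X ⊕ Fin k)) :
    Fml.liftSubst (fun a => (τ a).subst τ') =
      fun a => (Fml.liftSubst τ a).subst (Fml.liftSubst τ') := by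
  have key : ∀ t : L.Term (W ⊕ Fin m), (t.subst τ').relabel (Sum.map id Fin.succ) =
      (t.relabel (Sum.map id Fin.succ)).subst (Fml.liftSubst τ') := by
    intro t
    rw [relabel_subst, subst_relabel]
    congr 1
    funext a
    exact (liftSubst_relabel τ' a).symm
  funext a
  rcases a with x | i
  · exact key _
  · refine Fin.cases ?_ (fun j => ?_) i
    · rfl
    · exact key _

theorem Fml.subst_subst (A : Fml L V n) {m k : ℕ} (τ : V ⊕ Fin n → L.Term (W ⊕ Fin m))
    (τ' : W ⊕ Fin m → L.Term (X ⊕ Fin k)) :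
    (A.subst τ).subst τ' = A.subst (fun a => (τ a).subst τ') := by
  induction A generalizing m k with
  | rel R ts => simp only [Fml.subst, SkolemTableau.subst_subst]
  | neg A ih => simp only [Fml.subst, ih]
  | and A B ihA ihB => simp only [Fml.subst, ihA, ihB]
  | or A B ihA ihB => simp only [Fml.subst, ihA, ihB]
  | imp A B ihA ihB => simp only [Fml.subst, ihA, ihB]
  | all A ih => simp only [Fml.subst, ih, liftSubst_comp]
  | ex A ih => simp only [Fml.subst, ih, liftSubst_comp]

/-- The substitution that underlies `Fml.ground`. -/
def groundSubst (σ : V → L.Term Empty) (n : ℕ) : V ⊕ Fin n → L.Term (Empty ⊕ Fin n) :=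
  Sum.elim (fun x => (σ x).relabel Sum.inl) (fun i => .var (.inr i))

theorem liftSubst_groundSubst (σ : V → L.Term Empty) (n : ℕ) :
    Fml.liftSubst (groundSubst σ n) = groundSubst σ (n + 1) := by
  funext a
  rcases a with x | i
  · simp only [Fml.liftSubst, groundSubst, Sum.elim_inl, FirstOrder.Language.Term.relabel_relabel]
    rfl
  · refine Fin.cases ?_ (fun j => ?_) i <;> rfl

theorem Fml.ground_eq (σ : V → L.Term Empty) (A : Fml L V n) :
    A.ground σ = A.subst (groundSubst σ n) := rfl

theorem Fml.ground_all (σ : V → L.Term Empty) (A : Fml L V (n + 1)) :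
    (Fml.all A).ground σ = .all (A.ground σ) := by
  simp only [Fml.ground_eq, Fml.subst, liftSubst_groundSubst]

theorem Fml.ground_ex (σ : V → L.Term Empty) (A : Fml L V (n + 1)) :
    (Fml.ex A).ground σ = .ex (A.ground σ) := by
  simp only [Fml.ground_eq, Fml.subst, liftSubst_groundSubst]

theorem Fml.ground_inst (σ : V → L.Term Empty) (A : Fml L V 1) (t : L.Term V) :
    (A.inst t).ground σ = (A.ground σ).inst (t.subst σ) := by
  unfold Fml.inst
  rw [Fml.ground_eq, Fml.ground_eq, Fml.subst_subst, Fml.subst_subst]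
  congr 1
  funext a
  rcases a with x | i
  · simp only [groundSubst, Sum.elim_inl, FirstOrder.Language.Term.subst]
    rw [relabel_subst, relabel_eq_subst]
    rfl
  · simp only [groundSubst, Sum.elim_inr, FirstOrder.Language.Term.subst]
    rw [relabel_subst, subst_relabel]
    rfl

theorem IsDelta.ground {F : Fml L V 0} {A : Fml L V 1} (h : IsDelta F A) (σ : V → L.Term Empty) :
    IsDelta (F.ground σ) (A.ground σ) := by
  cases h with
  | ex A => rw [Fml.ground_ex]; exact .ex _
  | negAll A =>
    change IsDelta (.neg ((Fml.all A).ground σ)) (.neg (A.ground σ))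
    rw [Fml.ground_all]; exact .negAll _

theorem IsDelta.unique {F : Fml L V 0} {A B : Fml L V 1} (h : IsDelta F A) (h' : IsDelta F B) :
    A = B := by
  cases h <;> cases h' <;> rfl

/-! ### Function symbols and free variables of substitution instances -/

theorem Fml.hasFun_subst {A : Fml L V n} {g : Σ k, L.Functions k} {m : ℕ}
    (τ : V ⊕ Fin n → L.Term (W ⊕ Fin m)) (h : A.HasFun g) : (A.subst τ).HasFun g := by
  induction A generalizing m with
  | rel R ts => exact h.imp fun i hi => termHasFun_subst _ hi
  | neg A ih => exact ih τ h
  | and A B ihA ihB => exact h.imp (ihA τ) (ihB τ)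
  | or A B ihA ihB => exact h.imp (ihA τ) (ihB τ)
  | imp A B ihA ihB => exact h.imp (ihA τ) (ihB τ)
  | all A ih => exact ih _ h
  | ex A ih => exact ih _ h

theorem termHasFun_of_liftSubst {g : Σ k, L.Functions k} {τ : V ⊕ Fin n → L.Term (W ⊕ Fin m)}
    (h : ∃ a, TermHasFun g (Fml.liftSubst τ a)) : ∃ a, TermHasFun g (τ a) := by
  obtain ⟨x | i, h⟩ := h
  · exact ⟨_, termHasFun_relabel.1 h⟩
  · revert h
    refine Fin.cases (fun h => h.elim) (fun j h => ?_) i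
    exact ⟨.inr j, termHasFun_relabel.1 h⟩

theorem Fml.hasFun_of_subst {A : Fml L V n} {g : Σ k, L.Functions k} {m : ℕ}
    {τ : V ⊕ Fin n → L.Term (W ⊕ Fin m)} (h : (A.subst τ).HasFun g) :
    A.HasFun g ∨ ∃ a, TermHasFun g (τ a) := by
  induction A generalizing m with
  | rel R ts =>
    obtain ⟨i, hi⟩ := h
    exact (termHasFun_of_subst hi).imp (fun h => ⟨i, h⟩) id
  | neg A ih => exact ih h
  | and A B ihA ihB =>
    rcases h with h | h
    · exact (ihA h).imp Or.inl id
    · exact (ihB h).imp Or.inr id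
  | or A B ihA ihB =>
    rcases h with h | h
    · exact (ihA h).imp Or.inl id
    · exact (ihB h).imp Or.inr id
  | imp A B ihA ihB =>
    rcases h with h | h
    · exact (ihA h).imp Or.inl id
    · exact (ihB h).imp Or.inr id
  | all A ih => exact (ih h).imp id termHasFun_of_liftSubst
  | ex A ih => exact (ih h).imp id termHasFun_of_liftSubst

theorem Fml.hasFun_of_inst {A : Fml L V 1} {t : L.Term V} {g : Σ k, L.Functions k}
    (h : (A.inst t).HasFun g) : A.HasFun g ∨ TermHasFun g t := by
  refine (Fml.hasFun_of_subst h).imp id ?_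
  rintro ⟨x | i, h⟩
  · exact h.elim
  · exact termHasFun_relabel.1 h

theorem termOccurs_var_of_relabel {α β : Type*} {t : L.Term α} {r : α → β} {b : β}
    (h : TermOccurs (.var b) (t.relabel r)) : ∃ a, TermOccurs (.var a) t ∧ b = r a := by
  rw [relabel_eq_subst] at h
  obtain ⟨a, h₁, h₂⟩ := termOccurs_var_of_subst h
  exact ⟨a, h₁, by cases h₂; rfl⟩

/-- Every variable in the range of the substitution `τ` comes from a free variable that `τ` maps to
itself, or belongs to `Y`. -/
def VarsIn (Y : Set V) {n m : ℕ} (τ : V ⊕ Fin n → L.Term (V ⊕ Fin m)) : Prop :=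
  (∀ x, τ (.inl x) = .var (.inl x)) ∧ ∀ i x, TermOccurs (.var (.inl x)) (τ (.inr i)) → x ∈ Y

theorem VarsIn.lift {Y : Set V} {τ : V ⊕ Fin n → L.Term (V ⊕ Fin m)} (h : VarsIn Y τ) :
    VarsIn Y (Fml.liftSubst τ) := by
  refine ⟨fun x => by simp [Fml.liftSubst, h.1, FirstOrder.Language.Term.relabel], fun i x => ?_⟩
  refine Fin.cases (fun h => by cases h) (fun j hj => ?_) i
  obtain ⟨y | i, h₁, h₂⟩ := termOccurs_var_of_relabel hj
  · cases h₂
    exact h.2 j _ h₁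
  · cases h₂

theorem Fml.occurs_var_of_subst {Y : Set V} {A : Fml L V n} {m : ℕ} {x : V}
    {τ : V ⊕ Fin n → L.Term (V ⊕ Fin m)} (hτ : VarsIn Y τ) (h : (A.subst τ).Occurs (.var x)) :
    A.Occurs (.var x) ∨ x ∈ Y := by
  induction A generalizing m with
  | rel R ts =>
    obtain ⟨i, hi⟩ := h
    obtain ⟨y | j, h₁, h₂⟩ := termOccurs_var_of_subst hi
    · rw [hτ.1] at h₂
      cases h₂
      exact Or.inl ⟨i, h₁⟩
    · exact Or.inr (hτ.2 _ _ h₂)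
  | neg A ih => exact ih hτ h
  | and A B ihA ihB =>
    rcases h with h | h
    · exact (ihA hτ h).imp Or.inl id
    · exact (ihB hτ h).imp Or.inr id
  | or A B ihA ihB =>
    rcases h with h | h
    · exact (ihA hτ h).imp Or.inl id
    · exact (ihB hτ h).imp Or.inr id
  | imp A B ihA ihB =>
    rcases h with h | h
    · exact (ihA hτ h).imp Or.inl id
    · exact (ihB hτ h).imp Or.inr id
  | all A ih => exact ih hτ.lift h
  | ex A ih => exact ih hτ.lift h

theorem Fml.occurs_var_of_inst {A : Fml L V 1} {t : L.Term V} {x : V}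
    (h : (A.inst t).Occurs (.var x)) : A.Occurs (.var x) ∨ TermOccurs (.var x) t := by
  refine Fml.occurs_var_of_subst (Y := {x | TermOccurs (.var x) t})
    (τ := Sum.elim (fun x => .var (.inl x)) (fun _ => t.relabel Sum.inl)) ⟨fun _ => rfl, ?_⟩ h
  intro i x hx
  exact termOccurs_of_relabel (s := .var x) Sum.inl_injective hx

/-! ### Occurrences of ground terms -/

/-- Every subterm of `t` whose head symbol belongs to `Q` is one of the terms in `K`. -/
def TermGuarded (Q : Set (Σ k, L.Functions k)) (K : Set (L.Term V)) (t : L.Term (V ⊕ Fin n)) :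
    Prop :=
  ∀ r, TermOccurs r t → (∃ g ∈ Q, termHead r = some g) → ∃ s ∈ K, r = s.relabel Sum.inl

/-- Every term of the formula whose head symbol belongs to `Q` is one of the terms in `K`. -/
def Fml.Guarded (Q : Set (Σ k, L.Functions k)) (K : Set (L.Term V)) :
    {n : ℕ} → Fml L V n → Prop
  | _, .rel _ ts => ∀ i, TermGuarded Q K (ts i)
  | _, .neg A => Guarded Q K A
  | _, .and A B => Guarded Q K A ∧ Guarded Q K B
  | _, .or A B => Guarded Q K A ∧ Guarded Q K B
  | _, .imp A B => Guarded Q K A ∧ Guarded Q K B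
  | _, .all A => Guarded Q K A
  | _, .ex A => Guarded Q K A

variable {Q : Set (Σ k, L.Functions k)} {K : Set (L.Term V)}

theorem termGuarded_var (a : V ⊕ Fin n) : TermGuarded Q K (.var a : L.Term (V ⊕ Fin n)) := by
  rintro r h ⟨g, -, hg⟩
  rw [show r = _ from h] at hg
  cases hg

/-- Terms in `K` contain no bound variables and `τ` fixes the free ones, so guarded subterms of `t`
survive unchanged. Any other occurrence headed by `Q` comes from the range of `τ`. -/
theorem TermGuarded.subst {t : L.Term (V ⊕ Fin n)} (h : TermGuarded Q K t)
    {τ : V ⊕ Fin n → L.Term (V ⊕ Fin m)} (hv : ∀ x, τ (.inl x) = .var (.inl x))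
    (hτ : ∀ a, TermGuarded Q K (τ a)) : TermGuarded Q K (t.subst τ) := by
  rintro r hr ⟨g, hg, hrg⟩
  rcases termOccurs_subst hr with ⟨a, -, ha⟩ | ⟨r', h₁, h₂, rfl⟩
  · exact hτ a r ha ⟨g, hg, hrg⟩
  · obtain ⟨s, hs, rfl⟩ := h r' h₁ ⟨g, hg, h₂.trans hrg⟩
    refine ⟨s, hs, ?_⟩
    rw [relabel_subst, relabel_eq_subst]
    congr 1
    funext x
    exact hv x

theorem TermGuarded.lift {τ : V ⊕ Fin n → L.Term (V ⊕ Fin m)}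
    (hτ : ∀ a, TermGuarded Q K (τ a)) (a : V ⊕ Fin (n + 1)) :
    TermGuarded Q K (Fml.liftSubst τ a) := by
  have key : ∀ a, TermGuarded Q K ((τ a).relabel (Sum.map id (Fin.succ (n := m)))) := by
    intro a
    rw [relabel_eq_subst]
    exact (hτ a).subst (fun x => rfl) (fun b => termGuarded_var _)
  rcases a with x | i
  · exact key _
  · refine Fin.cases ?_ (fun j => ?_) i
    · exact termGuarded_var _
    · exact key _

theorem Fml.Guarded.subst {A : Fml L V n} (h : A.Guarded Q K) {m : ℕ}
    {τ : V ⊕ Fin n → L.Term (V ⊕ Fin m)} (hv : ∀ x, τ (.inl x) = .var (.inl x))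
    (hτ : ∀ a, TermGuarded Q K (τ a)) : (A.subst τ).Guarded Q K := by
  have hv' {n m : ℕ} {τ : V ⊕ Fin n → L.Term (V ⊕ Fin m)}
      (hv : ∀ x, τ (.inl x) = .var (.inl x)) (x : V) :
      Fml.liftSubst τ (.inl x) = .var (.inl x) := by
    simp [Fml.liftSubst, hv, FirstOrder.Language.Term.relabel]
  induction A generalizing m with
  | rel R ts => exact fun i => (h i).subst hv hτ
  | neg A ih => exact ih h hv hτ
  | and A B ihA ihB => exact ⟨ihA h.1 hv hτ, ihB h.2 hv hτ⟩
  | or A B ihA ihB => exact ⟨ihA h.1 hv hτ, ihB h.2 hv hτ⟩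
  | imp A B ihA ihB => exact ⟨ihA h.1 hv hτ, ihB h.2 hv hτ⟩
  | all A ih => exact ih h (hv' hv) (TermGuarded.lift hτ)
  | ex A ih => exact ih h (hv' hv) (TermGuarded.lift hτ)

theorem Fml.Guarded.inst {A : Fml L V 1} (h : A.Guarded Q K) {t : L.Term V}
    (ht : TermGuarded Q K (t.relabel Sum.inl : L.Term (V ⊕ Fin 0))) :
    (A.inst t).Guarded Q K := by
  refine Fml.Guarded.subst h (fun _ => rfl) ?_
  rintro (x | i)
  · exact termGuarded_var _
  · exact ht

theorem Fml.guarded_of_not_hasFun {A : Fml L V n} (h : ∀ g ∈ Q, ¬ A.HasFun g) :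
    A.Guarded Q K := by
  induction A with
  | rel R ts =>
    rintro i r hr ⟨g, hg, hrg⟩
    exact absurd ⟨i, termHasFun_of_occurs hr (termHasFun_of_head hrg)⟩ (h g hg)
  | neg A ih => exact ih h
  | and A B ihA ihB =>
    exact ⟨ihA fun g hg h' => h g hg (.inl h'), ihB fun g hg h' => h g hg (.inr h')⟩
  | or A B ihA ihB =>
    exact ⟨ihA fun g hg h' => h g hg (.inl h'), ihB fun g hg h' => h g hg (.inr h')⟩
  | imp A B ihA ihB =>
    exact ⟨ihA fun g hg h' => h g hg (.inl h'), ihB fun g hg h' => h g hg (.inr h')⟩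
  | all A ih => exact ih h
  | ex A ih => exact ih h

theorem Fml.hasFun_of_occurs {A : Fml L V n} {s : L.Term V} {g : Σ k, L.Functions k}
    (h : A.Occurs s) (hs : TermHasFun g s) : A.HasFun g := by
  induction A with
  | rel R ts => exact h.imp fun i hi => termHasFun_of_occurs hi (termHasFun_relabel.2 hs)
  | neg A ih => exact ih h
  | and A B ihA ihB => exact h.imp ihA ihB
  | or A B ihA ihB => exact h.imp ihA ihB
  | imp A B ihA ihB => exact h.imp ihA ihB
  | all A ih => exact ih h
  | ex A ih => exact ih h

theorem Fml.occurs_trans {A : Fml L V n} {r s : L.Term V}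
    (h : A.Occurs s) (hr : TermOccurs r s) : A.Occurs r := by
  induction A with
  | rel R ts => exact h.imp fun i hi => termOccurs_trans hi (termOccurs_relabel _ hr)
  | neg A ih => exact ih h
  | and A B ihA ihB => exact h.imp ihA ihB
  | or A B ihA ihB => exact h.imp ihA ihB
  | imp A B ihA ihB => exact h.imp ihA ihB
  | all A ih => exact ih h
  | ex A ih => exact ih h

theorem termOccurs_groundSubst {σ : V → L.Term Empty} {t : L.Term (V ⊕ Fin n)}
    (ht : TermGuarded Q K t) {s : L.Term Empty} {g : Σ k, L.Functions k}
    (hs : termHead s = some g) (hg : g ∈ Q)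
    (h : TermOccurs (s.relabel Sum.inl) (t.subst (groundSubst σ n))) :
    (∃ x, TermOccurs (.var (.inl x)) t ∧ TermOccurs s (σ x)) ∨
      ∃ r ∈ K, TermOccurs (r.relabel Sum.inl) t ∧ termHead r = some g := by
  have hs' : termHead (s.relabel Sum.inl : L.Term (Empty ⊕ Fin n)) = some g := by
    rw [relabel_eq_subst]; exact termHead_subst hs _
  rcases termOccurs_subst h with ⟨x | i, h₁, h₂⟩ | ⟨r, h₁, h₂, h₃⟩
  · exact Or.inl ⟨x, h₁, termOccurs_of_relabel Sum.inl_injective h₂⟩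
  -- A bound variable is left in place by grounding, and it has no head symbol.
  · rw [show s.relabel Sum.inl = _ from h₂] at hs'
    cases hs'
  · obtain ⟨r', hr', rfl⟩ := ht r h₁ ⟨g, hg, h₂.trans hs'⟩
    refine Or.inr ⟨r', hr', h₁, ?_⟩
    rw [hs', relabel_eq_subst] at h₂
    cases r' with
    | var => cases h₂
    | func => exact h₂

/-- An occurrence of a term headed by a guarded symbol in a ground instance lies inside the image
of a free variable or comes from a guarded term that occurs in the formula. -/
theorem Fml.occurs_ground {σ : V → L.Term Empty} {A : Fml L V n} (hA : A.Guarded Q K)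
    {s : L.Term Empty} {g : Σ k, L.Functions k} (hs : termHead s = some g) (hg : g ∈ Q)
    (h : (A.ground σ).Occurs s) :
    (∃ x ∈ A.fv, TermOccurs s (σ x)) ∨ ∃ r ∈ K, A.Occurs r ∧ termHead r = some g := by
  rw [Fml.ground_eq] at h
  change (∃ x, A.Occurs (.var x) ∧ _) ∨ _
  induction A with
  | rel R ts =>
    obtain ⟨i, hi⟩ := h
    exact (termOccurs_groundSubst (hA i) hs hg hi).imp (fun ⟨x, h₁, h₂⟩ => ⟨x, ⟨i, h₁⟩, h₂⟩)
      fun ⟨r, h₁, h₂, h₃⟩ => ⟨r, h₁, ⟨i, h₂⟩, h₃⟩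
  | neg A ih => exact ih hA h
  | and A B ihA ihB =>
    rcases h with h | h
    · exact (ihA hA.1 h).imp (fun ⟨x, h₁, h₂⟩ => ⟨x, .inl h₁, h₂⟩)
        fun ⟨r, h₁, h₂, h₃⟩ => ⟨r, h₁, .inl h₂, h₃⟩
    · exact (ihB hA.2 h).imp (fun ⟨x, h₁, h₂⟩ => ⟨x, .inr h₁, h₂⟩)
        fun ⟨r, h₁, h₂, h₃⟩ => ⟨r, h₁, .inr h₂, h₃⟩
  | or A B ihA ihB =>
    rcases h with h | h
    · exact (ihA hA.1 h).imp (fun ⟨x, h₁, h₂⟩ => ⟨x, .inl h₁, h₂⟩)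
        fun ⟨r, h₁, h₂, h₃⟩ => ⟨r, h₁, .inl h₂, h₃⟩
    · exact (ihB hA.2 h).imp (fun ⟨x, h₁, h₂⟩ => ⟨x, .inr h₁, h₂⟩)
        fun ⟨r, h₁, h₂, h₃⟩ => ⟨r, h₁, .inr h₂, h₃⟩
  | imp A B ihA ihB =>
    rcases h with h | h
    · exact (ihA hA.1 h).imp (fun ⟨x, h₁, h₂⟩ => ⟨x, .inl h₁, h₂⟩)
        fun ⟨r, h₁, h₂, h₃⟩ => ⟨r, h₁, .inl h₂, h₃⟩
    · exact (ihB hA.2 h).imp (fun ⟨x, h₁, h₂⟩ => ⟨x, .inr h₁, h₂⟩)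
        fun ⟨r, h₁, h₂, h₃⟩ => ⟨r, h₁, .inr h₂, h₃⟩
  | all A ih =>
    rw [Fml.subst, liftSubst_groundSubst] at h
    exact ih hA h
  | ex A ih =>
    rw [Fml.subst, liftSubst_groundSubst] at h
    exact ih hA h

end Subst

/-! ### Function symbols of components -/

theorem IsAlpha.hasFun {F : Fml L V 0} {S : Set (Fml L V 0)} (h : IsAlpha F S) {C : Fml L V 0}
    (hC : C ∈ S) {g : Σ k, L.Functions k} (hg : C.HasFun g) : F.HasFun g := by
  cases h with
  | and A B => rcases hC with rfl | rfl; exacts [Or.inl hg, Or.inr hg]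
  | negOr A B => rcases hC with rfl | rfl; exacts [Or.inl hg, Or.inr hg]
  | negImp A B => rcases hC with rfl | rfl; exacts [Or.inl hg, Or.inr hg]
  | negNeg A => cases hC; exact hg

theorem IsBeta.hasFun_left {F A B : Fml L V 0} (h : IsBeta F A B) {g : Σ k, L.Functions k}
    (hg : A.HasFun g) : F.HasFun g := by
  cases h <;> exact Or.inl hg

theorem IsBeta.hasFun_right {F A B : Fml L V 0} (h : IsBeta F A B) {g : Σ k, L.Functions k}
    (hg : B.HasFun g) : F.HasFun g := by
  cases h <;> exact Or.inr hg

theorem IsGamma.hasFun {F : Fml L V 0} {A : Fml L V 1} (h : IsGamma F A) {g : Σ k, L.Functions k}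
    (hg : A.HasFun g) : F.HasFun g := by
  cases h <;> exact hg

theorem IsDelta.hasFun {F : Fml L V 0} {A : Fml L V 1} (h : IsDelta F A) {g : Σ k, L.Functions k}
    (hg : A.HasFun g) : F.HasFun g := by
  cases h <;> exact hg

theorem IsDelta.fv_eq {F : Fml L V 0} {A : Fml L V 1} (h : IsDelta F A) : A.fv = F.fv := by
  cases h <;> rfl

theorem IsGamma.guarded {Q : Set (Σ k, L.Functions k)} {K : Set (L.Term V)} {F : Fml L V 0}
    {A : Fml L V 1} (h : IsGamma F A) (hF : F.Guarded Q K) : A.Guarded Q K := by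
  cases h <;> exact hF

theorem IsDelta.guarded {Q : Set (Σ k, L.Functions k)} {K : Set (L.Term V)} {F : Fml L V 0}
    {A : Fml L V 1} (h : IsDelta F A) (hF : F.Guarded Q K) : A.Guarded Q K := by
  cases h <;> exact hF

theorem termHasFun_skTerm {k : ℕ} {f : L.Functions k} {xs : Fin k → V} {g : Σ k, L.Functions k} :
    TermHasFun g (skTerm f xs) ↔ g = ⟨k, f⟩ := by
  refine ⟨?_, Or.inl⟩
  rintro (h | ⟨i, hi⟩)
  · exact h
  · exact hi.elim

theorem termOccurs_var_skTerm {k : ℕ} {f : L.Functions k} {xs : Fin k → V} {x : V} :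
    TermOccurs (.var x) (skTerm f xs) ↔ x ∈ Set.range xs := by
  constructor
  · rintro (h | ⟨i, hi⟩)
    · cases h
    · cases hi; exact ⟨i, rfl⟩
  · rintro ⟨i, rfl⟩
    exact Or.inr ⟨i, rfl⟩

/-! ### The applications of the `δ`-rule in a tableau -/

namespace Tableau

theorem deltas_finite {Δ : Set (Fml L V 0)} (T : Tableau Δ) : T.deltas.Finite := by
  induction T with
  | leaf => exact Set.finite_empty
  | alpha _ _ _ _ _ ih => exact ih
  | beta _ _ _ _ _ _ _ ih₁ ih₂ => exact ih₁.union ih₂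
  | gamma _ _ _ _ _ _ _ ih => exact ih
  | delta _ _ _ _ _ _ _ _ _ _ _ ih => exact ih.insert _

theorem deltas_spec {Δ : Set (Fml L V 0)} (T : Tableau Δ)
    {q : Fml L V 0 × Fml L V 1 × L.Term V} (hq : q ∈ T.deltas) :
    ∃ (k : ℕ) (f : L.Functions k) (xs : Fin k → V), q.2.2 = skTerm f xs ∧
      ⟨k, f⟩ ∈ T.skolems ∧ IsDelta q.1 q.2.1 ∧ Set.range xs = q.2.1.fv := by
  induction T with
  | leaf => exact hq.elim
  | alpha _ _ _ _ _ ih => exact ih hq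
  | beta _ _ _ _ _ T₁ T₂ ih₁ ih₂ =>
    rcases hq with hq | hq
    · obtain ⟨k, f, xs, h₁, h₂, h₃⟩ := ih₁ hq
      exact ⟨k, f, xs, h₁, List.mem_append_left _ h₂, h₃⟩
    · obtain ⟨k, f, xs, h₁, h₂, h₃⟩ := ih₂ hq
      exact ⟨k, f, xs, h₁, List.mem_append_right _ h₂, h₃⟩
  | gamma _ _ _ _ _ _ _ ih => exact ih hq
  | delta F A k f xs hF hA hf hxs hfv T ih =>
    rcases hq with rfl | hq
    · exact ⟨k, f, xs, rfl, List.mem_cons_self, hA, hfv⟩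
    · obtain ⟨k, f, xs, h₁, h₂, h₃⟩ := ih hq
      exact ⟨k, f, xs, h₁, List.mem_cons_of_mem _ h₂, h₃⟩

theorem head_mem_skolems {Δ : Set (Fml L V 0)} (T : Tableau Δ)
    {q : Fml L V 0 × Fml L V 1 × L.Term V} (hq : q ∈ T.deltas) {g : Σ k, L.Functions k}
    (hg : termHead q.2.2 = some g) : g ∈ T.skolems := by
  obtain ⟨k, f, xs, h₁, h₂, -⟩ := T.deltas_spec hq
  rw [h₁] at hg
  cases hg
  exact h₂

/-- A Skolem symbol determines the application of the `δ`-rule that introduces it. -/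
theorem deltas_unique {Δ : Set (Fml L V 0)} (T : Tableau Δ) (hT : T.skolems.Nodup)
    {q q' : Fml L V 0 × Fml L V 1 × L.Term V} (hq : q ∈ T.deltas) (hq' : q' ∈ T.deltas)
    {g : Σ k, L.Functions k} (h : termHead q.2.2 = some g) (h' : termHead q'.2.2 = some g) :
    q = q' := by
  induction T with
  | leaf => exact hq.elim
  | alpha _ _ _ _ _ ih => exact ih hT hq hq'
  | beta _ _ _ _ _ T₁ T₂ ih₁ ih₂ =>
    obtain ⟨hT₁, hT₂, hd⟩ := List.nodup_append'.1 hT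
    rcases hq with hq | hq <;> rcases hq' with hq' | hq'
    · exact ih₁ hT₁ hq hq'
    · exact (hd (T₁.head_mem_skolems hq h) (T₂.head_mem_skolems hq' h')).elim
    · exact (hd (T₁.head_mem_skolems hq' h') (T₂.head_mem_skolems hq h)).elim
    · exact ih₂ hT₂ hq hq'
  | gamma _ _ _ _ _ _ _ ih => exact ih hT hq hq'
  | delta F A k f xs hF hA hf hxs hfv T ih =>
    obtain ⟨hf, hT⟩ := List.nodup_cons.1 hT
    rcases hq with rfl | hq <;> rcases hq' with rfl | hq'
    · rfl
    · cases h
      exact (hf (T.head_mem_skolems hq' h')).elim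
    · cases h'
      exact (hf (T.head_mem_skolems hq h)).elim
    · exact ih hT hq hq'

/-- A property of formulas that is inherited along the tableau rules holds for all principal
formulas of `δ`-rules. -/
theorem deltas_induction {Φ : Fml L V 0 → Prop}
    (hα : ∀ {F S}, IsAlpha F S → Φ F → ∀ C ∈ S, Φ C)
    (hβ : ∀ {F A B}, IsBeta F A B → Φ F → Φ A ∧ Φ B)
    (hγ : ∀ {F A}, IsGamma F A → Φ F → ∀ x, Φ (A.inst (.var x)))
    {Δ : Set (Fml L V 0)} (T : Tableau Δ)
    (hδ : ∀ q ∈ T.deltas, Φ q.1 → Φ (q.2.1.inst q.2.2)) (hΔ : ∀ C ∈ Δ, Φ C) :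
    ∀ q ∈ T.deltas, Φ q.1 := by
  induction T with
  | leaf => exact fun q hq => hq.elim
  | alpha F S hF hS T ih =>
    refine ih hδ ?_
    rintro C (hC | hC)
    · exact hΔ C hC
    · exact hα hS (hΔ F hF) C hC
  | beta F A B hF hAB T₁ T₂ ih₁ ih₂ =>
    obtain ⟨hA, hB⟩ := hβ hAB (hΔ F hF)
    rintro q (hq | hq)
    · refine ih₁ (fun q hq => hδ q (Or.inl hq)) ?_ q hq
      rintro C (rfl | hC)
      exacts [hA, hΔ C hC]
    · refine ih₂ (fun q hq => hδ q (Or.inr hq)) ?_ q hq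
      rintro C (rfl | hC)
      exacts [hB, hΔ C hC]
  | gamma F A x hF hA hx T ih =>
    refine ih hδ ?_
    rintro C (rfl | hC)
    exacts [hγ hA (hΔ F hF) x, hΔ C hC]
  | delta F A k f xs hF hA hf hxs hfv T ih =>
    rintro q (rfl | hq)
    · exact hΔ F hF
    · refine ih (fun q hq => hδ q (Or.inr hq)) ?_ q hq
      rintro C (rfl | hC)
      exacts [hδ _ (Or.inl rfl) (hΔ F hF), hΔ C hC]

/-- Locates Skolem symbols: inside a subtableau whose root is free of them, they can only come from
its own `δ`-rules. This separates the two branches of a `β`-rule in the numbering below. -/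
theorem hasFun_of_deltas {Δ : Set (Fml L V 0)} (T : Tableau Δ)
    {q : Fml L V 0 × Fml L V 1 × L.Term V} (hq : q ∈ T.deltas) {g : Σ k, L.Functions k}
    (hg : q.1.HasFun g) : g ∈ T.skolems ∨ ∃ C ∈ Δ, C.HasFun g := by
  refine deltas_induction
    (Φ := fun C : Fml L V 0 => ∀ g, C.HasFun g → g ∈ T.skolems ∨ ∃ C ∈ Δ, C.HasFun g)
    (fun hS hF C hC g hg => hF g (hS.hasFun hC hg))
    (fun hAB hF => ⟨fun g hg => hF g (hAB.hasFun_left hg), fun g hg => hF g (hAB.hasFun_right hg)⟩)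
    (fun hA hF x g hg => (Fml.hasFun_of_inst hg).elim (fun hg => hF g (hA.hasFun hg)) False.elim)
    T ?_ (fun C hC g hg => Or.inr ⟨C, hC, hg⟩) q hq g hg
  intro q hq hF g hg
  obtain ⟨k, f, xs, h₁, h₂, h₃, -⟩ := T.deltas_spec hq
  rcases Fml.hasFun_of_inst hg with hg | hg
  · exact hF g (h₃.hasFun hg)
  · rw [h₁, termHasFun_skTerm] at hg
    exact Or.inl (hg ▸ h₂)

/-- The Skolem symbols can be numbered so that a Skolem symbol that occurs in the principal formula
of a `δ`-rule has a smaller number than the symbol introduced by the rule. -/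
theorem exists_skolem_order {Δ : Set (Fml L V 0)} (T : Tableau Δ) (hT : T.skolems.Nodup)
    (hΔ : ∀ g ∈ T.skolems, ∀ C ∈ Δ, ¬ C.HasFun g) :
    ∃ (r : (Σ k, L.Functions k) → ℕ) (N : ℕ), (∀ g, r g < N) ∧
      ∀ q ∈ T.deltas, ∀ f, termHead q.2.2 = some f → ∀ g ∈ T.skolems, q.1.HasFun g → r g < r f := by
  classical
  induction T with
  | leaf => exact ⟨fun _ => 0, 1, fun _ => one_pos, fun q hq => hq.elim⟩
  | alpha F S hF hS T ih =>
    refine ih hT fun g hg C hC h => ?_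
    rcases hC with hC | hC
    · exact hΔ g hg C hC h
    · exact hΔ g hg F hF (hS.hasFun hC h)
  | @beta Δ F A B hF hAB T₁ T₂ ih₁ ih₂ =>
    obtain ⟨hT₁, hT₂, hd⟩ := List.nodup_append'.1 hT
    have hA : ∀ g ∈ T₁.skolems ++ T₂.skolems, ∀ C ∈ insert A Δ, ¬ C.HasFun g := by
      rintro g hg C (rfl | hC) h
      exacts [hΔ g hg F hF (hAB.hasFun_left h), hΔ g hg C hC h]
    have hB : ∀ g ∈ T₁.skolems ++ T₂.skolems, ∀ C ∈ insert B Δ, ¬ C.HasFun g := by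
      rintro g hg C (rfl | hC) h
      exacts [hΔ g hg F hF (hAB.hasFun_right h), hΔ g hg C hC h]
    obtain ⟨r₁, N₁, hN₁, hr₁⟩ := ih₁ hT₁ fun g hg => hA g (List.mem_append_left _ hg)
    obtain ⟨r₂, N₂, hN₂, hr₂⟩ := ih₂ hT₂ fun g hg => hB g (List.mem_append_right _ hg)
    -- The branches introduce disjoint sets of symbols, and neither set occurs in principal formulas
    -- of the other branch, so the two numberings need no comparison.
    refine ⟨fun g => if g ∈ T₁.skolems then r₁ g else r₂ g, N₁ + N₂, fun g => ?_, ?_⟩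
    · dsimp only
      split_ifs
      · exact (hN₁ g).trans_le (Nat.le_add_right _ _)
      · exact (hN₂ g).trans_le (Nat.le_add_left _ _)
    · rintro q (hq | hq) f hf g hg h
      · have hg₁ : g ∈ T₁.skolems := (T₁.hasFun_of_deltas hq h).resolve_right
          fun ⟨C, hC, h⟩ => hA g hg C hC h
        have hf₁ := T₁.head_mem_skolems hq hf
        simp only [hg₁, hf₁, if_true]
        exact hr₁ q hq f hf g hg₁ h
      · have hg₂ : g ∈ T₂.skolems := (T₂.hasFun_of_deltas hq h).resolve_right
          fun ⟨C, hC, h⟩ => hB g hg C hC h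
        have hf₂ := T₂.head_mem_skolems hq hf
        dsimp only; rw [if_neg fun h => hd h hg₂, if_neg fun h => hd h hf₂]
        exact hr₂ q hq f hf g hg₂ h
  | gamma F A x hF hA hx T ih =>
    refine ih hT fun g hg C hC h => ?_
    rcases hC with rfl | hC
    · rcases Fml.hasFun_of_inst h with h | h
      · exact hΔ g hg F hF (hA.hasFun h)
      · exact h.elim
    · exact hΔ g hg C hC h
  | delta F A k f xs hF hA hf hxs hfv T ih =>
    obtain ⟨hf, hT⟩ := List.nodup_cons.1 hT
    obtain ⟨r, N, hN, hr⟩ := ih hT (by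
      rintro g hg C (rfl | hC) h
      · rcases Fml.hasFun_of_inst h with h | h
        · exact hΔ g (List.mem_cons_of_mem _ hg) F hF (hA.hasFun h)
        · rw [termHasFun_skTerm] at h
          exact hf (h ▸ hg)
      · exact hΔ g (List.mem_cons_of_mem _ hg) C hC h)
    -- The symbol introduced lowest in the tree may occur in all later formulas, while its own
    -- principal formula has no Skolem symbol. It gets `0` and the others are shifted.
    refine ⟨fun g => if g = ⟨k, f⟩ then 0 else r g + 1, N + 1, fun g => ?_, ?_⟩
    · dsimp only
      split_ifs
      · exact Nat.succ_pos _
      · exact Nat.succ_lt_succ (hN g)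
    · rintro q (rfl | hq) f' hf' g hg h
      · exact (hΔ g hg F hF h).elim
      · have hf₁ : f' ≠ ⟨k, f⟩ := fun h => hf (h ▸ T.head_mem_skolems hq hf')
        dsimp only
        rw [if_neg hf₁]
        split_ifs with hgf
        · exact Nat.succ_pos _
        · exact Nat.succ_lt_succ
            (hr q hq f' hf' g ((List.mem_cons.1 hg).resolve_left hgf) h)

/-! ### Ranking the ground Skolem witnesses. -/

section Ground

variable {σ : V → L.Term Empty} {Γ : Set (Fml L V 0)} {T : Tableau Γ}

/-- Every Skolem symbol occurs in a tableau only at the top of its Skolem term. -/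
theorem guarded_of_deltas (hΓ : ∀ g ∈ T.skolems, ∀ C ∈ Γ, ¬ C.HasFun g) :
    ∀ q ∈ T.deltas, q.1.Guarded {g | g ∈ T.skolems} ((fun q => q.2.2) '' T.deltas) ∧
      (q.2.1.inst q.2.2).Guarded {g | g ∈ T.skolems} ((fun q => q.2.2) '' T.deltas) := by
  have step : ∀ q ∈ T.deltas, q.1.Guarded {g | g ∈ T.skolems} ((fun q => q.2.2) '' T.deltas) →
      (q.2.1.inst q.2.2).Guarded {g | g ∈ T.skolems} ((fun q => q.2.2) '' T.deltas) := by
    intro q hq h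
    obtain ⟨k, f, xs, h₁, h₂, h₃, -⟩ := T.deltas_spec hq
    refine Fml.Guarded.inst (h₃.guarded h) ?_
    · intro r hr hrg
      rw [h₁] at hr
      rcases hr with rfl | ⟨i, hi⟩
      · exact ⟨q.2.2, ⟨q, hq, rfl⟩, h₁ ▸ rfl⟩
      · exact termGuarded_var _ r hi hrg
  have main := T.deltas_induction
    (Φ := Fml.Guarded {g | g ∈ T.skolems} ((fun q => q.2.2) '' T.deltas))
    ?_ ?_ ?_ step (fun C hC => Fml.guarded_of_not_hasFun fun g hg => hΓ g hg C hC)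
  · exact fun q hq => ⟨main q hq, step q hq (main q hq)⟩
  · intro F S hS h C hC
    cases hS with
    | and A B => rcases hC with rfl | rfl; exacts [h.1, h.2]
    | negOr A B => rcases hC with rfl | rfl; exacts [h.1, h.2]
    | negImp A B => rcases hC with rfl | rfl; exacts [h.1, h.2]
    | negNeg A => cases hC; exact h
  · intro F A B hAB h
    cases hAB <;> exact h
  · intro F A hA h x
    exact Fml.Guarded.inst (hA.guarded h) (termGuarded_var _)

theorem height_lt_of_occurs {k : ℕ} {f : L.Functions k} {xs : Fin k → V} {x : V}
    (hx : x ∈ Set.range xs) {s : L.Term Empty} (h : TermOccurs s (σ x)) :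
    termHeight s < termHeight ((skTerm f xs).subst σ) := by
  obtain ⟨i, rfl⟩ := hx
  exact (termHeight_le_of_occurs h).trans_lt (termHeight_lt f (fun i => σ (xs i)) i)

/-- The height of a ground Skolem term depends only on the heights of the `σ x`, for `x` among its
arguments, and grows with the set of arguments. -/
theorem height_le_of_range {k k' : ℕ} {f : L.Functions k} {f' : L.Functions k'} {xs : Fin k → V}
    {xs' : Fin k' → V} (h : Set.range xs ⊆ Set.range xs') :
    termHeight ((skTerm f xs).subst σ) ≤ termHeight ((skTerm f' xs').subst σ) := by
  refine Finset.sup_le fun i _ => ?_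
  obtain ⟨j, hj⟩ := h ⟨i, rfl⟩
  change termHeight (σ (xs i)) < _
  rw [← hj]
  exact termHeight_lt f' (fun i => σ (xs' i)) j

/-- The `δ`-rules of a tableau can be ranked so that the rank strictly decreases when one passes
from a `δ`-rule to another one whose ground witness occurs in the instance of the first. -/
theorem exists_rank (hT : T.skolems.Nodup) (hΓ : ∀ g ∈ T.skolems, ∀ C ∈ Γ, ¬ C.HasFun g) :
    ∃ rank : Fml L V 0 × Fml L V 1 × L.Term V → ℕ, ∀ q ∈ T.deltas, ∀ q' ∈ T.deltas, q ≠ q' →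
      ((q'.2.1.inst q'.2.2).ground σ).Occurs (q.2.2.subst σ) → rank q < rank q' := by
  obtain ⟨r, N, hN, hr⟩ := T.exists_skolem_order hT hΓ
  -- Since `r < N`, this encodes the lexicographic order on height and symbol number.
  refine ⟨fun q => termHeight (q.2.2.subst σ) * N + (termHead q.2.2).elim 0 r, ?_⟩
  intro q hq q' hq' hne h
  obtain ⟨k, f, xs, h₁, h₂, h₃, h₄⟩ := T.deltas_spec hq
  obtain ⟨k', f', xs', h₁', h₂', h₃', h₄'⟩ := T.deltas_spec hq'
  have hh : termHead q.2.2 = some ⟨k, f⟩ := by rw [h₁]; rfl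
  have hh' : termHead q'.2.2 = some ⟨k', f'⟩ := by rw [h₁']; rfl
  -- The Skolem term has exactly the free variables of the matrix as arguments, so instantiating the
  -- matrix adds no variable.
  have hv : ∀ x, (q'.2.1.inst q'.2.2).Occurs (.var x) → x ∈ Set.range xs' := by
    intro x hx
    rcases Fml.occurs_var_of_inst hx with hx | hx
    · rw [h₄']; exact hx
    · rwa [h₁', termOccurs_var_skTerm] at hx
  simp only [hh, hh', Option.elim_some]
  rcases Fml.occurs_ground (guarded_of_deltas hΓ q' hq').2 (termHead_subst hh σ) h₂ h with
    ⟨x, hx, hs⟩ | ⟨-, ⟨q₁, hq₁, rfl⟩, hs, hhead⟩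
  -- The witness sits inside some `σ x` with `x` an argument of the Skolem term of `q'`, so its
  -- height is strictly smaller.
  · have hlt := height_lt_of_occurs (f := f') (hv x hx) hs
    rw [← h₁'] at hlt
    calc _ < termHeight (q.2.2.subst σ) * N + N := Nat.add_lt_add_left (hN _) _
      _ = (termHeight (q.2.2.subst σ) + 1) * N := by ring
      _ ≤ termHeight (q'.2.2.subst σ) * N := Nat.mul_le_mul_right _ hlt
      _ ≤ _ := Nat.le_add_right _ _
  -- The Skolem term of `q` itself occurs in the tableau formula. Its symbol then has a smaller
  -- number, and its arguments are among those of `q'`, which bounds the height.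
  · obtain rfl := T.deltas_unique hT hq₁ hq hhead hh
    have hlt : r ⟨k, f⟩ < r ⟨k', f'⟩ := by
      refine hr q' hq' _ hh' _ h₂ ?_
      rcases Fml.hasFun_of_inst (Fml.hasFun_of_occurs hs (termHasFun_of_head hhead)) with hf | hf
      · exact h₃'.hasFun hf
      · rw [h₁', termHasFun_skTerm] at hf
        exact (hne (T.deltas_unique hT hq hq' hh (hf ▸ hh'))).elim
    have hle : termHeight (q₁.2.2.subst σ) ≤ termHeight (q'.2.2.subst σ) := by
      rw [h₁, h₁']
      refine height_le_of_range fun x hx => hv x (Fml.occurs_trans hs ?_)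
      simpa only [h₁, termOccurs_var_skTerm] using hx
    exact Nat.add_lt_add_of_le_of_lt (Nat.mul_le_mul_right _ hle) hlt

/-- The ground witness of a `δ`-rule does not occur in the ground principal formula. -/
theorem not_occurs_principal (hT : T.skolems.Nodup)
    (hΓ : ∀ g ∈ T.skolems, ∀ C ∈ Γ, ¬ C.HasFun g) {q : Fml L V 0 × Fml L V 1 × L.Term V}
    (hq : q ∈ T.deltas) : ¬ (q.1.ground σ).Occurs (q.2.2.subst σ) := by
  intro h
  obtain ⟨r, N, -, hr⟩ := T.exists_skolem_order hT hΓ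
  obtain ⟨k, f, xs, h₁, h₂, h₃, h₄⟩ := T.deltas_spec hq
  have hh : termHead q.2.2 = some ⟨k, f⟩ := by rw [h₁]; rfl
  -- Inside some `σ x` the witness would be lower than itself; as a Skolem term of the formula its
  -- symbol would have a number below its own.
  rcases Fml.occurs_ground (guarded_of_deltas hΓ q hq).1 (termHead_subst hh σ) h₂ h with
    ⟨x, hx, hs⟩ | ⟨s, -, hs, hhead⟩
  · rw [← h₃.fv_eq, ← h₄] at hx
    have := height_lt_of_occurs (f := f) hx hs
    rw [h₁] at this
    exact this.false
  · exact (hr q hq _ hh _ h₂ (Fml.hasFun_of_occurs hs (termHasFun_of_head hhead))).false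

end Ground

end Tableau

/-! ### A weight for termination. -/

/-- If `rank` strictly increases along `R`, then there is a bounded weight on the subsets of `K`
that strictly increases whenever an element `q` is added and its `R`-successors are removed. -/
theorem exists_weight {ι : Type*} [DecidableEq ι] (K : Finset ι) (R : ι → ι → Prop)
    [∀ q, DecidablePred (R q)] (rank : ι → ℕ)
    (h : ∀ q ∈ K, ∀ q' ∈ K, q ≠ q' → R q q' → rank q < rank q') :
    ∃ (W : Finset ι → ℕ) (M : ℕ), (∀ E ⊆ K, W E ≤ M) ∧
      ∀ E ⊆ K, ∀ q ∈ K, q ∉ E → W E < W (insert q (E.filter fun q' => ¬ R q q')) := by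
  let b := K.card + 1
  let m := K.sup rank
  -- Low rank weighs most: with base `K.card + 1`, one element outweighs all elements of `K` of
  -- higher rank together.
  let f : ι → ℕ := fun q => b ^ (m - rank q)
  refine ⟨fun E => ∑ q ∈ E, f q, ∑ q ∈ K, f q,
    fun E hE => Finset.sum_le_sum_of_subset hE, fun E hE q hq hqE => ?_⟩
  have hb : 0 < b := Nat.succ_pos _
  dsimp only
  rw [Finset.sum_insert (fun hmem => hqE (Finset.mem_filter.1 hmem).1),
    ← Finset.sum_filter_add_sum_filter_not E (R q)]
  refine Nat.add_lt_add_right ?_ _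
  refine Nat.lt_of_mul_lt_mul_left (a := b) ?_
  calc b * ∑ q' ∈ E with R q q', f q' = ∑ q' ∈ E with R q q', b * f q' := Finset.mul_sum ..
    _ ≤ (E.filter (R q)).card • f q := by
        refine Finset.sum_le_card_nsmul _ _ _ fun q' hq' => ?_
        obtain ⟨hq'E, hR⟩ := Finset.mem_filter.1 hq'
        have h₁ := h q hq q' (hE hq'E) (fun h => hqE (h ▸ hq'E)) hR
        have h₂ : rank q' ≤ m := Finset.le_sup (hE hq'E)
        calc b * b ^ (m - rank q') = b ^ (m - rank q' + 1) := (pow_succ' _ _).symm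
          _ ≤ b ^ (m - rank q) := Nat.pow_le_pow_right hb (by omega)
    _ ≤ K.card * f q :=
        Nat.mul_le_mul_right _ (Finset.card_le_card ((Finset.filter_subset _ _).trans hE))
    _ < b * f q := Nat.mul_lt_mul_of_pos_right (Nat.lt_succ_self _) (pow_pos hb _)

theorem IsAlpha.finite {F : Fml L V 0} {S : Set (Fml L V 0)} (h : IsAlpha F S) : S.Finite := by
  cases h <;> simp

/-! ### Derivations with prescribed open leaves -/

namespace GS3

variable {sk : Set (Fml L Empty 0 × L.Term Empty)} {Δ : Set (Fml L Empty 0)}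

theorem Leaf.unique {d : GS3 sk Δ} {p : TreePath} {S S' : Set (Fml L Empty 0)}
    (h : d.Leaf p S) (h' : d.Leaf p S') : S = S' := by
  induction d generalizing p with
  | hyp => exact h.2.trans h'.2.symm
  | ax => exact h.elim
  | weak _ _ _ _ ih | alpha _ _ _ _ _ ih | gamma _ _ _ _ _ _ ih | delta _ _ _ _ _ _ _ _ ih =>
    obtain ⟨r, rfl, h⟩ := h
    obtain ⟨r', hr, h'⟩ := h'
    cases hr
    exact ih h h'
  | beta _ _ _ _ _ _ _ ih₁ ih₂ =>
    obtain ⟨r, rfl, h⟩ | ⟨r, rfl, h⟩ := h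
    · obtain ⟨r', hr, h'⟩ | ⟨r', hr, h'⟩ := h'
      · cases hr; exact ih₁ h h'
      · cases hr
    · obtain ⟨r', hr, h'⟩ | ⟨r', hr, h'⟩ := h'
      · cases hr
      · cases hr; exact ih₂ h h'

/-- Each rule adds finitely many formulas. This supplies the finiteness needed to weaken a leaf of
`θ` back to `σΓ`, which may be infinite. -/
theorem Leaf.finite_diff {Z : Set (Fml L Empty 0)} {d : GS3 sk Δ} {p : TreePath}
    {S : Set (Fml L Empty 0)} (h : d.Leaf p S) (hZ : (Δ \ Z).Finite) : (S \ Z).Finite := by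
  have ins : ∀ {Δ : Set (Fml L Empty 0)} {A}, (Δ \ Z).Finite → (insert A Δ \ Z).Finite :=
    fun h => (h.insert _).subset fun C hC => hC.1.imp id fun h => ⟨h, hC.2⟩
  induction d generalizing p with
  | hyp => rwa [h.2]
  | ax => exact h.elim
  | weak A Δ' hΔ d ih =>
    obtain ⟨r, rfl, h⟩ := h
    exact ih h (hZ.subset (by rw [hΔ]; exact Set.sdiff_subset_sdiff_left (Set.subset_insert _ _)))
  | alpha F S hF hS d ih =>
    obtain ⟨r, rfl, h⟩ := h
    refine ih h ?_
    rw [Set.union_sdiff_distrib]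
    exact hZ.union hS.finite.sdiff
  | beta F A B hF hAB d₁ d₂ ih₁ ih₂ =>
    obtain ⟨r, rfl, h⟩ | ⟨r, rfl, h⟩ := h
    exacts [ih₁ h (ins hZ), ih₂ h (ins hZ)]
  | gamma F A t hF hA d ih =>
    obtain ⟨r, rfl, h⟩ := h
    exact ih h (ins hZ)
  | delta F A t hF hA hsk hfresh d ih =>
    obtain ⟨r, rfl, h⟩ := h
    exact ih h (ins hZ)

/-- The part of a tree above an open leaf of one of its initial parts. -/
theorem InitialPart.exists_subtree {d₀ d : GS3 sk Δ} (h : d₀.InitialPart d) {p : TreePath}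
    {P : Set (Fml L Empty 0)} (hp : d₀.Leaf p P) :
    ∃ e : GS3 sk P, ∀ r S, e.Leaf r S → d.Leaf (p ++ r) S := by
  induction h generalizing p with
  | hyp d =>
    obtain ⟨rfl, rfl⟩ := hp
    exact ⟨d, fun r S h => h⟩
  | ax => exact hp.elim
  | weak _ _ _ _ _ _ ih | alpha _ _ _ _ _ _ _ ih | gamma _ _ _ _ _ _ _ _ ih
  | delta _ _ _ _ _ _ _ _ _ _ ih =>
    obtain ⟨r, rfl, hp⟩ := hp
    obtain ⟨e, he⟩ := ih hp
    exact ⟨e, fun r S h => ⟨_, rfl, he r S h⟩⟩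
  | beta _ _ _ _ _ _ _ _ _ _ _ ih₁ ih₂ =>
    obtain ⟨r, rfl, hp⟩ | ⟨r, rfl, hp⟩ := hp
    · obtain ⟨e, he⟩ := ih₁ hp
      exact ⟨e, fun r S h => Or.inl ⟨_, rfl, he r S h⟩⟩
    · obtain ⟨e, he⟩ := ih₂ hp
      exact ⟨e, fun r S h => Or.inr ⟨_, rfl, he r S h⟩⟩

/-- `Δ` is the root of a tree all of whose open leaves have sequents in `Good`. -/
def Derives (sk : Set (Fml L Empty 0 × L.Term Empty)) (Good : Set (Set (Fml L Empty 0)))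
    (Δ : Set (Fml L Empty 0)) : Prop :=
  ∃ d : GS3 sk Δ, ∀ p S, d.Leaf p S → S ∈ Good

/-! ### Closure of derivability under the rules. -/

namespace Derives

variable {Good : Set (Set (Fml L Empty 0))}

theorem hyp (h : Δ ∈ Good) : Derives sk Good Δ :=
  ⟨.hyp Δ, fun _ _ hS => hS.2 ▸ h⟩

theorem ax (A : Fml L Empty 0) (hA : A ∈ Δ) (hn : Fml.neg A ∈ Δ) : Derives sk Good Δ :=
  ⟨.ax A hA hn, fun _ _ hS => hS.elim⟩

theorem weak (A : Fml L Empty 0) (h : Derives sk Good Δ) : Derives sk Good (insert A Δ) := by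
  obtain ⟨d, hd⟩ := h
  exact ⟨.weak A Δ rfl d, fun _ S ⟨_, _, hS⟩ => hd _ S hS⟩

theorem alpha {F : Fml L Empty 0} {S : Set (Fml L Empty 0)} (hF : F ∈ Δ) (hS : IsAlpha F S)
    (h : Derives sk Good (Δ ∪ S)) : Derives sk Good Δ := by
  obtain ⟨d, hd⟩ := h
  exact ⟨.alpha F S hF hS d, fun _ S ⟨_, _, hS⟩ => hd _ S hS⟩

theorem beta {F A B : Fml L Empty 0} (hF : F ∈ Δ) (hAB : IsBeta F A B)
    (h₁ : Derives sk Good (insert A Δ)) (h₂ : Derives sk Good (insert B Δ)) :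
    Derives sk Good Δ := by
  obtain ⟨d₁, hd₁⟩ := h₁
  obtain ⟨d₂, hd₂⟩ := h₂
  refine ⟨.beta F A B hF hAB d₁ d₂, ?_⟩
  rintro p S (⟨_, _, hS⟩ | ⟨_, _, hS⟩)
  exacts [hd₁ _ S hS, hd₂ _ S hS]

theorem gamma {F : Fml L Empty 0} {A : Fml L Empty 1} (t : L.Term Empty) (hF : F ∈ Δ)
    (hA : IsGamma F A) (h : Derives sk Good (insert (A.inst t) Δ)) : Derives sk Good Δ := by
  obtain ⟨d, hd⟩ := h
  exact ⟨.gamma F A t hF hA d, fun _ S ⟨_, _, hS⟩ => hd _ S hS⟩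

theorem delta {F : Fml L Empty 0} {A : Fml L Empty 1} {t : L.Term Empty} (hF : F ∈ Δ)
    (hA : IsDelta F A) (hsk : (F, t) ∈ sk) (hfresh : ∀ G ∈ Δ, ¬ G.Occurs t)
    (h : Derives sk Good (insert (A.inst t) Δ)) : Derives sk Good Δ := by
  obtain ⟨d, hd⟩ := h
  exact ⟨.delta F A t hF hA hsk hfresh d, fun _ S ⟨_, _, hS⟩ => hd _ S hS⟩

/-- The weakening rule drops one formula at a time, so a finite tree can only drop finitely many. -/
theorem weaken {Δ' : Set (Fml L Empty 0)} (h : Derives sk Good Δ') (hs : Δ' ⊆ Δ)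
    (hf : (Δ \ Δ').Finite) : Derives sk Good Δ := by
  have key : Derives sk Good (Δ \ Δ' ∪ Δ') := by
    refine Set.Finite.induction_on (motive := fun X _ => Derives sk Good (X ∪ Δ')) _ hf ?_ ?_
    · rwa [Set.empty_union]
    · intro A X _ _ ih
      rw [Set.insert_union]
      exact ih.weak A
  rwa [Set.sdiff_union_of_subset hs] at key

theorem weaken_union {X : Set (Fml L Empty 0)} (h : Derives sk Good Δ) (hf : X.Finite) :
    Derives sk Good (Δ ∪ X) :=
  h.weaken Set.subset_union_left (hf.subset fun _ hC => hC.1.resolve_left hC.2)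

end Derives

/-- Replays a tree with additional formulas `G q`, `q ∈ E`, in all sequents.  A `δ`-rule that
introduces `G q` is skipped if `q ∈ E`; otherwise the additional formulas in which its witness
occurs are dropped beforehand, and `q` is added to `E`. -/
theorem replay {ι : Type*} [DecidableEq ι] {G : ι → Fml L Empty 0} {tm : ι → L.Term Empty}
    [∀ q, DecidablePred fun q' => (G q').Occurs (tm q)]
    {K : Finset ι} (hK : ∀ F t A, (F, t) ∈ sk → IsDelta F A → ∃ q ∈ K, t = tm q ∧ A.inst t = G q)
    {Good : Set (Set (Fml L Empty 0))} {Inv : Finset ι → Prop}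
    (hInv : ∀ E, ∀ q ∈ K, q ∉ E → Inv E →
      Inv (insert q (E.filter fun q' => ¬ (G q').Occurs (tm q))))
    (d : GS3 sk Δ)
    (hleaf : ∀ p S, d.Leaf p S → ∀ E, Inv E → Derives sk Good (S ∪ G '' (E : Set ι)))
    (E : Finset ι) (hE : Inv E) : Derives sk Good (Δ ∪ G '' (E : Set ι)) := by
  induction d generalizing E with
  | hyp Δ => exact hleaf [] Δ ⟨rfl, rfl⟩ E hE
  | ax A hA hn => exact .ax A (Or.inl hA) (Or.inl hn)
  | weak A Δ' h d ih =>
    rw [h, Set.insert_union]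
    exact (ih (fun p S hS => hleaf _ S ⟨p, rfl, hS⟩) E hE).weak A
  | alpha F S hF hS d ih =>
    refine .alpha (Or.inl hF) hS ?_
    rw [Set.union_right_comm]
    exact ih (fun p S hS => hleaf _ S ⟨p, rfl, hS⟩) E hE
  | beta F A B hF hAB d₁ d₂ ih₁ ih₂ =>
    refine .beta (Or.inl hF) hAB ?_ ?_
    · rw [← Set.insert_union]
      exact ih₁ (fun p S hS => hleaf _ S (Or.inl ⟨p, rfl, hS⟩)) E hE
    · rw [← Set.insert_union]
      exact ih₂ (fun p S hS => hleaf _ S (Or.inr ⟨p, rfl, hS⟩)) E hE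
  | gamma F A t hF hA d ih =>
    refine .gamma t (Or.inl hF) hA ?_
    rw [← Set.insert_union]
    exact ih (fun p S hS => hleaf _ S ⟨p, rfl, hS⟩) E hE
  | delta F A t hF hA hsk hfresh d ih =>
    have ih := ih fun p S hS => hleaf _ S ⟨p, rfl, hS⟩
    obtain ⟨q, hq, rfl, hG⟩ := hK F t A hsk hA
    rw [hG] at ih
    by_cases hqE : q ∈ E
    · have := ih E hE
      rwa [Set.insert_union, Set.insert_eq_of_mem (Set.mem_union_right _
        (Set.mem_image_of_mem G (Finset.mem_coe.2 hqE)))] at this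
    · have := ih _ (hInv E q hq hqE hE)
      rw [Finset.coe_insert, Set.image_insert_eq, Set.insert_union, Set.union_insert,
        Set.insert_idem, ← hG] at this
      -- Read from the root: first weaken `E` to its filtered part, then apply the `δ`-rule, whose
      -- witness is now fresh.
      refine Derives.weaken (.delta (Or.inl hF) hA hsk ?_ this) ?_ ?_
      · rintro C (hC | ⟨q', hq', rfl⟩)
        · exact hfresh C hC
        · exact (Finset.mem_filter.1 hq').2
      · exact Set.union_subset_union_right _
          (Set.image_mono (Finset.coe_subset.2 (Finset.filter_subset _ _)))
      · refine (E.finite_toSet.image G).subset ?_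
        rintro C ⟨hC | hC, hC'⟩
        · exact (hC' (Or.inl hC)).elim
        · exact hC

/-- Trees whose open leaves carry sequents of open leaves of `θ₀` or `θ₁`, up to additional
formulas, are bilinked to these trees. -/
theorem exists_bilink {Δ₀ Δ₁ : Set (Fml L Empty 0)} (π : GS3 sk Δ) (θ₀ : GS3 sk Δ₀)
    (θ₁ : GS3 sk Δ₁) (X : TreePath → Set (Fml L Empty 0)) (Y : Set TreePath)
    (h : ∀ s S, π.Leaf s S →
      (∃ p P, θ₀.Leaf p P ∧ S = X p ∪ P) ∨ ∃ b, b ∈ Y ∧ θ₁.Leaf b S) :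
    ∃ μ₀ μ₁ : TreePath → Option TreePath, π.Bilink θ₀ θ₁ μ₀ μ₁ ∧
      (∀ s b, μ₁ s = some b → b ∈ Y) ∧
      (∀ s p, μ₀ s = some p → ∀ S P, π.Leaf s S → θ₀.Leaf p P → S = X p ∪ P) ∧
      (∀ s b, μ₁ s = some b → ∀ S R, π.Leaf s S → θ₁.Leaf b R → S = R) := by
  classical
  -- A leaf may qualify for both trees; choosing one target for each position keeps the domains
  -- disjoint.
  have hc : ∀ s, ∃ x y : Option TreePath,
      (∀ p, x = some p → ∃ P, π.Leaf s (X p ∪ P) ∧ θ₀.Leaf p P) ∧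
      (∀ b, y = some b → b ∈ Y ∧ ∃ S, π.Leaf s S ∧ θ₁.Leaf b S) ∧
      (x = none ∨ y = none) ∧ (s ∈ π.leaves → x ≠ none ∨ y ≠ none) := by
    intro s
    by_cases hs : s ∈ π.leaves
    · obtain ⟨S, hS⟩ := hs
      rcases h s S hS with ⟨p, P, hP, rfl⟩ | ⟨b, hb, hS'⟩
      · refine ⟨some p, none, ?_, by simp, by simp, by simp⟩
        rintro p' hp
        cases hp
        exact ⟨P, hS, hP⟩
      · refine ⟨none, some b, by simp, ?_, by simp, by simp⟩
        rintro b' hb'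
        cases hb'
        exact ⟨hb, S, hS, hS'⟩
    · exact ⟨none, none, by simp, by simp, by simp, fun h => (hs h).elim⟩
  choose μ₀ μ₁ h₀ h₁ hd hcov using hc
  refine ⟨μ₀, μ₁, ⟨?_, ?_, ?_, ?_⟩, fun s b hb => (h₁ s b hb).1, ?_, ?_⟩
  · intro s p hp
    obtain ⟨P, hS, hP⟩ := h₀ s p hp
    exact ⟨_, P, hS, hP, Set.subset_union_right⟩
  · intro s b hb
    obtain ⟨-, S, hS, hR⟩ := h₁ s b hb
    exact ⟨S, S, hS, hR, subset_rfl⟩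
  · refine Set.eq_empty_of_forall_notMem ?_
    rintro s ⟨⟨p, hp⟩, ⟨b, hb⟩⟩
    rcases hd s with h | h
    · rw [h] at hp; cases hp
    · rw [h] at hb; cases hb
  · ext s
    constructor
    · rintro (⟨p, hp⟩ | ⟨b, hb⟩)
      · obtain ⟨P, hS, -⟩ := h₀ s p hp
        exact ⟨_, hS⟩
      · obtain ⟨-, S, hS, -⟩ := h₁ s b hb
        exact ⟨_, hS⟩
    · intro hs
      exact (hcov s hs).imp Option.ne_none_iff_exists'.1 Option.ne_none_iff_exists'.1
  · intro s p hp S P hS hP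
    obtain ⟨P', hS', hP'⟩ := h₀ s p hp
    rw [hP.unique hP', hS.unique hS']
  · intro s b hb S R hS hR
    obtain ⟨-, S', hS', hR'⟩ := h₁ s b hb
    rw [hR.unique hR', hS.unique hS']

end GS3

/-- `skolemTable` forgets the matrix, but a `δ`-formula determines it. -/
theorem Tableau.exists_delta_of_skolemTable {σ : V → L.Term Empty} {Γ : Set (Fml L V 0)}
    (T : Tableau Γ) {F : Fml L Empty 0} {t : L.Term Empty} {A : Fml L Empty 1}
    (h : (F, t) ∈ T.skolemTable σ) (hA : IsDelta F A) :
    ∃ q ∈ T.deltas, t = q.2.2.subst σ ∧ A.inst t = (q.2.1.inst q.2.2).ground σ := by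
  obtain ⟨F', A', t', hq, he⟩ := h
  cases he
  obtain ⟨-, -, -, -, -, hD, -⟩ := T.deltas_spec hq
  exact ⟨_, hq, rfl, by rw [hA.unique (hD.ground σ), Fml.ground_inst]⟩

end SkolemTableau

/-! ### The `δ`-theorem. -/

theorem mainTheorem2 {L : FirstOrder.Language.{u, v}} {V : Type w} {Γ : Set (Fml L V 0)}
    (T : Tableau Γ) (hT : T.Fresh) (σ : V → L.Term Empty) (hσ : T.ClosedBy σ)
    (hΓ : ∀ f ∈ T.skolems, ∀ A ∈ Γ, ¬ (A.ground σ).HasFun f)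
    (F : Fml L V 0) (D : Fml L V 1) (δ : L.Term V) (hδ : (F, D, δ) ∈ T.deltas)
    (θ : GS3 (T.skolemTable σ) (Fml.ground σ '' Γ))
    (hθ : θ.formulas ⊆ Fml.ground σ '' T.formulas)
    (hθΓ : ∀ p S, θ.Leaf p S → Fml.ground σ '' Γ ⊆ S)
    (B : Set TreePath) (hB : ∀ b ∈ B, ∃ S, θ.Leaf b S ∧ F.ground σ ∈ S)
    (π₀ : GS3 (T.skolemTable σ) (Fml.ground σ '' Γ)) (hπ₀ : π₀.InitialPart θ) :
    ∃ (π₁ : GS3 (T.skolemTable σ) (Fml.ground σ '' Γ)) (μπ μθ : TreePath → Option TreePath),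
      π₁.Bilink π₀ θ μπ μθ ∧
      (∀ s b, μθ s = some b → b ∉ B) ∧
      (∀ s p, μπ s = some p → IsPrefixOf p B →
        ∀ S P, π₁.Leaf s S → π₀.Leaf p P → S = insert ((D.inst δ).ground σ) P) ∧
      (∀ s p, μπ s = some p → ¬ IsPrefixOf p B →
        ∀ S P, π₁.Leaf s S → π₀.Leaf p P → S = P) ∧
      (∀ s b, μθ s = some b →
        ∀ S R, π₁.Leaf s S → θ.Leaf b R → S = R) := by
  classical
  have hΓ' : ∀ g ∈ T.skolems, ∀ C ∈ Γ, ¬ C.HasFun g :=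
    fun g hg C hC h => hΓ g hg C hC (Fml.hasFun_subst _ h)
  let G : Fml L V 0 × Fml L V 1 × L.Term V → Fml L Empty 0 := fun q => (q.2.1.inst q.2.2).ground σ
  let tm : Fml L V 0 × Fml L V 1 × L.Term V → L.Term Empty := fun q => q.2.2.subst σ
  let K := T.deltas_finite.toFinset
  have memK : ∀ {q}, q ∈ K ↔ q ∈ T.deltas := T.deltas_finite.mem_toFinset
  let X : TreePath → Set (Fml L Empty 0) :=
    fun p => if IsPrefixOf p B then {(D.inst δ).ground σ} else ∅
  let Good : Set (Set (Fml L Empty 0)) :=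
    {S | (∃ p P, π₀.Leaf p P ∧ S = X p ∪ P) ∨ ∃ b, b ∈ Bᶜ ∧ θ.Leaf b S}
  suffices H : GS3.Derives (T.skolemTable σ) Good (Fml.ground σ '' Γ) by
    obtain ⟨π₁, hπ₁⟩ := H
    obtain ⟨μπ, μθ, hbi, h₁, h₂, h₃⟩ := GS3.exists_bilink π₁ π₀ θ X Bᶜ hπ₁
    refine ⟨π₁, μπ, μθ, hbi, h₁, fun s p hs hp S P hS hP => ?_, fun s p hs hp S P hS hP => ?_, h₃⟩
    · simpa [X, hp] using h₂ s p hs S P hS hP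
    · simpa [X, hp] using h₂ s p hs S P hS hP
  have hK : ∀ F t A, (F, t) ∈ T.skolemTable σ → IsDelta F A →
      ∃ q ∈ K, t = tm q ∧ A.inst t = G q := by
    intro F t A h hA
    obtain ⟨q, hq, h⟩ := T.exists_delta_of_skolemTable h hA
    exact ⟨q, memK.2 hq, h⟩
  obtain ⟨rank, hrank⟩ := Tableau.exists_rank (σ := σ) hT.2 hΓ'
  obtain ⟨W, M, hM, hW⟩ := exists_weight K (fun q q' => (G q').Occurs (tm q)) rank
    fun q hq q' hq' => hrank q (memK.1 hq) q' (memK.1 hq')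
  let step (q) (E : Finset (Fml L V 0 × Fml L V 1 × L.Term V)) :=
    insert q (E.filter fun q' => ¬ (G q').Occurs (tm q))
  have hstep : ∀ E ⊆ K, ∀ q ∈ K, step q E ⊆ K := fun E hE q hq =>
    Finset.insert_subset hq ((Finset.filter_subset _ _).trans hE)
  have fin : ∀ E : Finset (Fml L V 0 × Fml L V 1 × L.Term V),
      (G '' (E : Set (Fml L V 0 × Fml L V 1 × L.Term V))).Finite := fun E => E.finite_toSet.image G
  -- Induction on the distance of the weight from its bound `M`; a restart is legitimate as soon as
  -- the weight has grown.
  have key : ∀ n, ∀ E ⊆ K, M - W E = n →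
      GS3.Derives (T.skolemTable σ) Good (Fml.ground σ '' Γ ∪ G '' (E : Set _)) := by
    intro n
    induction n using Nat.strong_induction_on with
    | _ n IH =>
    intro E₀ hE₀ hn
    have restart : ∀ E ⊆ K, W E₀ < W E →
        GS3.Derives (T.skolemTable σ) Good (Fml.ground σ '' Γ ∪ G '' (E : Set _)) := by
      intro E hE hlt
      have := hM E hE
      exact IH (M - W E) (by omega) E hE rfl
    have hδK : (F, D, δ) ∈ K := memK.2 hδ
    refine GS3.replay hK (Inv := fun E => E ⊆ K ∧ W E₀ ≤ W E)
      (fun E q hq hqE hE => ⟨hstep E hE.1 q hq, hE.2.trans (hW E hE.1 q hq hqE).le⟩) π₀ ?_ E₀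
      ⟨hE₀, le_rfl⟩
    rintro p P hP E ⟨hE, hle⟩
    by_cases hp : IsPrefixOf p B
    swap
    · refine GS3.Derives.weaken_union (.hyp (Or.inl ⟨p, P, hP, ?_⟩)) (fin E)
      simp [X, hp]
    by_cases hδE : (F, D, δ) ∈ E
    · have hX : insert ((D.inst δ).ground σ) P ∈ Good := by
        refine Or.inl ⟨p, P, hP, ?_⟩
        simp [X, hp]
      have := GS3.Derives.weaken_union (sk := T.skolemTable σ) (.hyp hX) (fin E)
      rw [Set.insert_union] at this
      change GS3.Derives _ _ (insert (G (F, D, δ)) _) at this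
      rwa [Set.insert_eq_of_mem (Set.mem_union_right _
        (Set.mem_image_of_mem G (Finset.mem_coe.2 hδE)))] at this
    obtain ⟨e, he⟩ := hπ₀.exists_subtree hP
    refine GS3.replay hK
      -- The distinguished application is absent at the start of this replay, so finding it in `E`
      -- at a leaf means that some addition has raised the weight.
      (Inv := fun E => E ⊆ K ∧ W E₀ ≤ W E ∧ ((F, D, δ) ∈ E → W E₀ < W E))
      (fun E q hq hqE hE => ⟨hstep E hE.1 q hq, hE.2.1.trans (hW E hE.1 q hq hqE).le,
        fun _ => hE.2.1.trans_lt (hW E hE.1 q hq hqE)⟩) e ?_ E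
      ⟨hE, hle, fun h => (hδE h).elim⟩
    rintro r S hS E ⟨hE, hle, hlt⟩
    have hθS := he r S hS
    by_cases hb : p ++ r ∈ B
    swap
    · exact GS3.Derives.weaken_union (.hyp (Or.inr ⟨_, hb, hθS⟩)) (fin E)
    obtain ⟨S', hS', hFS⟩ := hB _ hb
    obtain rfl := hθS.unique hS'
    have hΓS := hθΓ _ _ hθS
    have hfin : (S \ Fml.ground σ '' Γ).Finite := hθS.finite_diff (by simp)
    have hfin' : ((S ∪ G '' (E : Set _)) \ Fml.ground σ '' Γ).Finite := by
      rw [Set.union_sdiff_distrib]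
      exact hfin.union (fin E).sdiff
    by_cases hδE : (F, D, δ) ∈ E
    · refine (restart E hE (hlt hδE)).weaken (Set.union_subset_union_left _ hΓS)
        (hfin'.subset (Set.sdiff_subset_sdiff_right Set.subset_union_left))
    have hgo := restart _ (hstep E hE _ hδK) (hle.trans_lt (hW E hE _ hδK hδE))
    obtain ⟨-, -, -, -, -, hD, -⟩ := T.deltas_spec hδ
    have hfilter : G '' ((E.filter fun q' => ¬ (G q').Occurs (tm (F, D, δ)) :
        Finset _) : Set (Fml L V 0 × Fml L V 1 × L.Term V)) ⊆ G '' (E : Set _) :=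
      Set.image_mono (Finset.coe_subset.2 (Finset.filter_subset _ _))
    rw [Finset.coe_insert, Set.image_insert_eq, Set.union_insert] at hgo
    -- The restart sequent need not contain the principal formula, which the `δ`-rule requires.
    have hgo' := (hgo.weak (F.ground σ))
    rw [Set.insert_comm] at hgo'
    change GS3.Derives _ _ (insert ((D.inst δ).ground σ) _) at hgo'
    rw [Fml.ground_inst] at hgo'
    refine GS3.Derives.weaken (.delta (Set.mem_insert _ _) (hD.ground σ)
      ⟨F, D, δ, hδ, rfl⟩ ?_ hgo') ?_ ?_
    -- Freshness of `σδ` has three sources: the rank argument for the principal formula, the absence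
    -- of Skolem symbols in `σΓ`, and the filter for the remaining instances.
    · rintro C (rfl | ⟨A, hA, rfl⟩ | ⟨q', hq', rfl⟩)
      · exact Tableau.not_occurs_principal hT.2 hΓ' hδ
      · intro h
        obtain ⟨k, f, xs, h₁, h₂, -⟩ := T.deltas_spec hδ
        refine hΓ _ h₂ A hA (Fml.hasFun_of_occurs h (termHasFun_subst _ ?_))
        exact termHasFun_of_head (congrArg termHead h₁)
      · exact (Finset.mem_filter.1 hq').2
    · exact Set.insert_subset (Or.inl hFS) (Set.union_subset_union hΓS hfilter)
    · exact hfin'.subset (Set.sdiff_subset_sdiff_right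
        (Set.subset_union_left.trans (Set.subset_insert _ _)))
  simpa using key _ ∅ (Finset.empty_subset _) rfl
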